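/- **Setting.** Let $\mathfrak l,\mathfrak g,\mathfrak g'$ be finite-dimensional Lie algebras over $\mathbb K\in\{\mathbb R,\mathbb C\}$. Elements of $\bigwedge^2\mathfrak g$ are identified with skew-symmetric maps $\mathfrak g^*\to\mathfrak g$; $\operatorname{ad}^*_x$, $i^*$, $\upsilon^*$ denote transposes, and $\circlearrowleft$ a sum over cyclic permutations of $(\xi,\eta,\zeta)$. A *Lie quasi-bialgebra* $\mathcal G=(\mathfrak g,[\,,],\varpi,\varphi)$ consists of a Lie algebra $1$-cocycle $\varpi:\mathfrak g\to\bigwedge^2\mathfrak g$ and $\varphi\in\bigwedge^3\mathfrak g$ such that $\langle\xi\otimes\eta\otimes\zeta,\operatorname{ad}_x^{(3)}\varphi\rangle=\circlearrowleft\langle\xi,\varpi_{\varpi_x\eta}\zeta\rangle$ and $\operatorname{Alt}\,(\varpi\otimes1\otimes1)\varphi=0$. Its double is $\mathfrak d=\mathfrak g\oplus\mathfrak g^*$ with $[x,\xi]=\varpi_x\xi-\operatorname{ad}_x^*\xi$, $[\xi,\eta]=\langle\xi\otimes\eta\otimes1,\varphi\rangle-\langle\xi,\varpi_\bullet\eta\rangle$.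 It is *bidynamical over $\mathfrak l$* if there are an injective morphism $i:\mathfrak l\to\mathfrak g$ with $\varpi_{i(z)}=0$ for $z\in\mathfrak l$ and $\varphi\equiv0$ mod $i(\mathfrak l)$ (i.e. $\varphi$ vanishes in $\bigwedge^3(\mathfrak g/i(\mathfrak l))$) and a reductive decomposition $\mathfrak g=\mathfrak l\oplus\mathfrak m$, $[\mathfrak l,\mathfrak m]\subset\mathfrak m$. Let $p_{\mathfrak l}:\mathfrak g\to\mathfrak l$ be the projection along $\mathfrak m$ and $s=p_{\mathfrak l}^*:\mathfrak l^*\to\mathfrak g^*$. A *morphism* $\upsilon:\mathcal G\to\mathcal G'$ of bidynamical Lie quasi-bialgebras (with decompositions $\mathfrak g=\mathfrak l\oplus\mathfrak m$, $\mathfrak g'=\mathfrak l\oplus\mathfrak m'$) is a Lie algebra morphism $\upsilon:\mathfrak g\to\mathfrak g'$ with $\upsilon i=i'$, $\upsilon(\mathfrak m)\subset\mathfrak m'$, $\upsilon\varpi_x\upsilon^*=\varpi'_{\upsilon(x)}$ for $x\in\mathfrak g$, and $\upsilon^{(3)}\varphi=\varphi'$. The *canonical $\ell$-matrix* $l^{\rm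 can}_{\mathcal G,\mathfrak l,\mathfrak m}$ is the unique formal map $l$ at $0$ from $\mathfrak l^*$ to the linear maps $\mathfrak g^*\to\mathfrak g$ with $l_0=0$ and $$d_pl(p)\zeta=\operatorname{ad}_{sp}(l_p\zeta+\zeta)-(l_p\widetilde\zeta_p+\widetilde\zeta_p)-p_{\mathfrak l}l_p\zeta-l_p\,s\,i^*\zeta\quad(\zeta\in\mathfrak g^*),$$ where $\widetilde\zeta_p=p_{\mathfrak g^*}\operatorname{ad}_{sp}(l_p\zeta+\zeta)$, brackets being taken in $\mathfrak d$. A *formal dynamical $\ell$-matrix* for $\mathcal G$ is a formal map $l$ with values in $\bigwedge^2\mathfrak g$ satisfying $\circlearrowleft\big(\langle\zeta,d_pl(i^*\xi)\eta\rangle-\langle\zeta,[l_p\xi,l_p\eta]\rangle-\langle\zeta,\varpi_{l_p\xi}\eta\rangle\big)=\langle\xi\otimes\eta\otimes\zeta,\varphi\rangle$ and $d_pl(\operatorname{ad}^*_zp)+\varpi_{i(z)}+\operatorname{ad}_{i(z)}l_p+l_p\operatorname{ad}^*_{i(z)}=0$ for $z\in\mathfrak l$. **Proposition.** Let $\upsilon:\mathcal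 G\to\mathcal G'$ be a morphism of bidynamical Lie quasi-bialgebras over $\mathfrak l$. (1) $\upsilon\, l^{\rm can}_{\mathcal G,\mathfrak l,\mathfrak m}\,\upsilon^*=l^{\rm can}_{\mathcal G',\mathfrak l,\mathfrak m'}$. Moreover, if $l$ is a formal dynamical $\ell$-matrix for $\mathcal G$ with $l_0=0$ and $l_psp=0$, then $l=l^{\rm can}_{\mathcal G,\mathfrak l,\mathfrak m}$, and $\upsilon l\upsilon^*$ is a formal dynamical $\ell$-matrix for $\mathcal G'$ with the same two properties (with respect to $s'$). (2) Let $\mathbb K=\mathbb R$, let $G,G'$ be Lie groups with Lie algebras $\mathfrak g,\mathfrak g'$, $G$ connected, and let $U\subset\mathfrak l^*$ be open and connected with $0\in U$. Let $l$ be an analytic map on $U$ whose Taylor expansion at $0$ is $l^{\rm can}_{\mathcal G,\mathfrak l,\mathfrak m}$. Then $\upsilon l\upsilon^*$ is analytic on $U$ with Taylor expansion $l^{\rm can}_{\mathcal G',\mathfrak l,\mathfrak m'}$ at $0$; and if $l'$ is any analytic map on $U$ with Taylor expansion $l^{\rm can}_{\mathcal G',\mathfrak l,\mathfrak m'}$ at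 $0$, then $\upsilon l_p\upsilon^*=l'_p$ for all $p\in U$. Let further $\pi:G\to\bigwedge^2\mathfrak g$, $\pi':G'\to\bigwedge^2\mathfrak g'$ be smooth group $1$-cocycles with $T_1\pi=\varpi$, $T_1\pi'=\varpi'$, and let $\psi:G\to G'$ be a morphism of Lie groups with $T_1\psi=\upsilon$. Equip the trivial groupoid $U\times G\times U$, with product $(p,x,q)(q,y,r)=(p,xy,r)$, with the bracket $$\begin{aligned}\{f,g\}_{(p,x,q)}=&\ \langle p,[\delta f,\delta g]\rangle-\langle q,[\delta'f,\delta'g]\rangle-\langle Dg,i\delta f\rangle-\langle D'g,i\delta'f\rangle+\langle Df,i\delta g\rangle+\langle D'f,i\delta'g\rangle\\&-\langle Df,l_pDg\rangle+\langle Df,\pi_xDg\rangle+\langle D'f,l_qD'g\rangle,\end{aligned}$$ where $\delta f,\delta'f\in\mathfrak l$ are the derivatives in the two $U$-factors and $\langle Df,u\rangle=\frac{d}{dt}|_{0}f(p,e^{tu}x,q)$, $\langle D'f,u\rangle=\frac{d}{dt}|_{0}f(p,xe^{tu},q)$; equip $U\times G'\times U$ with the analogous bracket given by $l'$ and $\pi'$.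 Then $\Psi(p,x,q)=(p,\psi(x),q)$ is a Poisson groupoid morphism: it is smooth, a morphism of groupoids over $\mathrm{id}_U$, and $\{f\circ\Psi,g\circ\Psi\}=\{f,g\}'\circ\Psi$ for all $f,g\in C^\infty(U\times G'\times U)$. -/

import Mathlib

open scoped Manifold ContDiff Topology
open Module (Dual)

noncomputable section

namespace Bidyn

universe u v w

/-! ### Lie quasi-bialgebras

Elements of `⋀²𝔤` are identified with skew-symmetric maps `𝔤* → 𝔤`, and elements `φ` of `⋀³𝔤`
with the maps `(ξ, η) ↦ ⟨ξ ⊗ η ⊗ 1, φ⟩ ∈ 𝔤`, so that `⟨ξ ⊗ η ⊗ ζ, φ⟩ = ζ (φ ξ η)`.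
The notation `ad*ₓ` stands for the transpose of `adₓ`, and `i*` for the transpose of `i`. -/

section Algebra

variable {𝕜 : Type u} [Field 𝕜]

/-- The transpose `ad*ₓ : 𝔤* → 𝔤*` of `adₓ`, that is `⟨ad*ₓ ξ, y⟩ = ⟨ξ, [x, y]⟩`. -/
def adT {𝔤 : Type v} [LieRing 𝔤] [LieAlgebra 𝕜 𝔤] (x : 𝔤) : Dual 𝕜 𝔤 →ₗ[𝕜] Dual 𝕜 𝔤 :=
  (LieAlgebra.ad 𝕜 𝔤 x).dualMap

/-- Sum over the cyclic permutations of three arguments. -/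
def cycl {A : Type v} {B : Type w} [Add B] (F : A → A → A → B) (ξ η ζ : A) : B :=
  F ξ η ζ + F η ζ ξ + F ζ ξ η

/-- A Lie quasi-bialgebra structure `(ϖ, φ)` on the Lie algebra `𝔤`. -/
structure LieQuasiBialgebra (𝕜 : Type u) [Field 𝕜] (𝔤 : Type v) [LieRing 𝔤] [LieAlgebra 𝕜 𝔤] where
  /-- the cobracket `ϖ : 𝔤 → ⋀²𝔤` -/
  ϖ : 𝔤 →ₗ[𝕜] Dual 𝕜 𝔤 →ₗ[𝕜] 𝔤
  /-- the associator `φ ∈ ⋀³𝔤` -/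
  φ : Dual 𝕜 𝔤 →ₗ[𝕜] Dual 𝕜 𝔤 →ₗ[𝕜] 𝔤
  ϖ_skew : ∀ (x : 𝔤) (ξ η : Dual 𝕜 𝔤), η (ϖ x ξ) = -ξ (ϖ x η)
  φ_skew_left : ∀ ξ η : Dual 𝕜 𝔤, φ ξ η = -φ η ξ
  φ_skew_right : ∀ ξ η ζ : Dual 𝕜 𝔤, ζ (φ ξ η) = -η (φ ξ ζ)
  /-- `ϖ` is a Lie algebra `1`-cocycle with values in `⋀²𝔤` -/
  cocycle : ∀ (x y : 𝔤) (ξ : Dual 𝕜 𝔤), ϖ ⁅x, y⁆ ξ =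
    (⁅x, ϖ y ξ⁆ + ϖ y (adT x ξ)) - (⁅y, ϖ x ξ⁆ + ϖ x (adT y ξ))
  /-- `⟨ξ ⊗ η ⊗ ζ, adₓ⁽³⁾ φ⟩ = ↻ ⟨ξ, ϖ_{ϖₓ η} ζ⟩` -/
  coJacobi : ∀ (x : 𝔤) (ξ η ζ : Dual 𝕜 𝔤),
    ζ (φ (adT x ξ) η) + ζ (φ ξ (adT x η)) + (adT x ζ) (φ ξ η) =
      cycl (fun ξ η ζ => ξ (ϖ (ϖ x η) ζ)) ξ η ζ
  /-- the compatibility `Alt (ϖ ⊗ 1 ⊗ 1) φ = 0` -/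
  pentagon : ∀ ξ η ζ : Dual 𝕜 𝔤,
    cycl (fun ξ η ζ => ϖ (φ ξ η) ζ - φ (ξ ∘ₗ ϖ.flip η) ζ) ξ η ζ = 0

/-- A bidynamical Lie quasi-bialgebra over `𝔩`, together with a chosen reductive decomposition
`𝔤 = 𝔩 ⊕ 𝔪`. -/
structure BidynLQB (𝕜 : Type u) [Field 𝕜] (𝔩 : Type v) [LieRing 𝔩] [LieAlgebra 𝕜 𝔩]
    (𝔤 : Type w) [LieRing 𝔤] [LieAlgebra 𝕜 𝔤] extends LieQuasiBialgebra 𝕜 𝔤 where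
  /-- the inclusion `i : 𝔩 → 𝔤` -/
  i : 𝔩 →ₗ⁅𝕜⁆ 𝔤
  i_injective : Function.Injective i
  /-- the complement `𝔪` -/
  𝔪 : Submodule 𝕜 𝔤
  isCompl : IsCompl (LinearMap.range (i : 𝔩 →ₗ[𝕜] 𝔤)) 𝔪
  reductive : ∀ z : 𝔩, ∀ u ∈ 𝔪, ⁅i z, u⁆ ∈ 𝔪
  /-- `ϖ` vanishes on `𝔩` -/
  ϖ_i : ∀ z : 𝔩, ϖ (i z) = 0
  /-- `φ ≡ 0` modulo `𝔩`, that is, the image of `φ` in `⋀³(𝔤 / 𝔩)` is zero -/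
  φ_mod : ∀ ξ η ζ : Dual 𝕜 𝔤, (∀ z, ξ (i z) = 0) → (∀ z, η (i z) = 0) → (∀ z, ζ (i z) = 0) →
    ζ (φ ξ η) = 0

variable {𝔩 : Type v} [LieRing 𝔩] [LieAlgebra 𝕜 𝔩] {𝔤 : Type w} [LieRing 𝔤] [LieAlgebra 𝕜 𝔤]

/-- The Lie bracket of the canonical double `𝔡 = 𝔤 ⊕ 𝔤*`. -/
def LieQuasiBialgebra.doubleBracket (𝓖 : LieQuasiBialgebra 𝕜 𝔤) :
    (𝔤 × Dual 𝕜 𝔤) →ₗ[𝕜] (𝔤 × Dual 𝕜 𝔤) →ₗ[𝕜] (𝔤 × Dual 𝕜 𝔤) :=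
  LinearMap.mk₂ 𝕜
    (fun X Y =>
      (⁅X.1, Y.1⁆ + 𝓖.ϖ X.1 Y.2 - 𝓖.ϖ Y.1 X.2 + 𝓖.φ X.2 Y.2,
        -adT X.1 Y.2 + adT Y.1 X.2 - X.2 ∘ₗ 𝓖.ϖ.flip Y.2))
    (by
      intro X X' Y
      ext <;> simp [adT]
      · abel
      · ring)
    (by
      intro c X Y
      ext <;> simp [adT]
      · module
      · ring)
    (by
      intro X Y Y'
      ext <;> simp [adT]
      · abel
      · ring)
    (by
      intro c X Y
      ext <;> simp [adT]
      · module
      · ring)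

namespace BidynLQB

variable (𝓖 : BidynLQB 𝕜 𝔩 𝔤)

/-- The inclusion `i : 𝔩 → 𝔤` as a linear map. -/
def iLin : 𝔩 →ₗ[𝕜] 𝔤 := (𝓖.i : 𝔩 →ₗ[𝕜] 𝔤)

/-- The transpose `i* : 𝔤* → 𝔩*`, i.e. restriction to `𝔩`. -/
def iT : Dual 𝕜 𝔤 →ₗ[𝕜] Dual 𝕜 𝔩 := 𝓖.iLin.dualMap

/-- The projection `p_𝔩 : 𝔤 → 𝔩` along `𝔪`. -/
def projL : 𝔤 →ₗ[𝕜] 𝔩 :=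
  LinearMap.linearProjOfIsCompl 𝓖.𝔪 (𝓖.i : 𝔩 →ₗ[𝕜] 𝔤) 𝓖.i_injective 𝓖.isCompl

/-- The transpose `s : 𝔩* → 𝔤*` of `p_𝔩`. -/
def s : Dual 𝕜 𝔩 →ₗ[𝕜] Dual 𝕜 𝔤 := 𝓖.projL.dualMap

/-- A morphism of bidynamical Lie quasi-bialgebras over `𝔩`. -/
structure Hom {𝔤' : Type*} [LieRing 𝔤'] [LieAlgebra 𝕜 𝔤']
    (𝓖 : BidynLQB 𝕜 𝔩 𝔤) (𝓖' : BidynLQB 𝕜 𝔩 𝔤') where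
  toLieHom : 𝔤 →ₗ⁅𝕜⁆ 𝔤'
  map_i : ∀ z : 𝔩, toLieHom (𝓖.i z) = 𝓖'.i z
  map_𝔪 : ∀ u ∈ 𝓖.𝔪, toLieHom u ∈ 𝓖'.𝔪
  map_ϖ : ∀ x (ξ : Dual 𝕜 𝔤'),
    toLieHom (𝓖.ϖ x ((toLieHom : 𝔤 →ₗ[𝕜] 𝔤').dualMap ξ)) = 𝓖'.ϖ (toLieHom x) ξ
  map_φ : ∀ ξ η : Dual 𝕜 𝔤',
    toLieHom (𝓖.φ ((toLieHom : 𝔤 →ₗ[𝕜] 𝔤').dualMap ξ) ((toLieHom : 𝔤 →ₗ[𝕜] 𝔤').dualMap η)) =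
      𝓖'.φ ξ η

end BidynLQB

/-- The conjugation `X ↦ f ∘ X ∘ f*` from maps `𝔤* → 𝔤` to maps `𝔤'* → 𝔤'`. -/
def conj {A : Type*} {B : Type*} [AddCommGroup A] [Module 𝕜 A] [AddCommGroup B] [Module 𝕜 B]
    (f : A →ₗ[𝕜] B) : (Dual 𝕜 A →ₗ[𝕜] A) →ₗ[𝕜] (Dual 𝕜 B →ₗ[𝕜] B) :=
  (LinearMap.llcomp 𝕜 (Dual 𝕜 B) A B f) ∘ₗ (LinearMap.lcomp 𝕜 A f.dualMap)

end Algebra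

/-! ### Formal maps -/

/-- A function `V → E` is homogeneous polynomial of degree `k` if it is the restriction to the
diagonal of a `k`-linear map. -/
def IsHomogPoly (𝕜 : Type u) [Field 𝕜] {V : Type v} {E : Type w} [AddCommGroup V] [Module 𝕜 V]
    [AddCommGroup E] [Module 𝕜 E] (k : ℕ) (f : V → E) : Prop :=
  ∃ M : MultilinearMap 𝕜 (fun _ : Fin k => V) E, ∀ p, f p = M fun _ => p

/-- A formal map at `0` from `V` to `E`: the sequence of its homogeneous terms. -/
@[ext]
structure FormalMap (𝕜 : Type u) [Field 𝕜] (V : Type v) (E : Type w)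
    [AddCommGroup V] [Module 𝕜 V] [AddCommGroup E] [Module 𝕜 E] where
  /-- the homogeneous term of degree `k` -/
  term : ℕ → V → E
  isHomogPoly : ∀ k, IsHomogPoly 𝕜 k (term k)

section Homog

variable {𝕜 : Type u} [Field 𝕜] {V : Type*} [AddCommGroup V] [Module 𝕜 V]
  {E : Type*} [AddCommGroup E] [Module 𝕜 E] {F : Type*} [AddCommGroup F] [Module 𝕜 F]
  {H : Type*} [AddCommGroup H] [Module 𝕜 H]

theorem IsHomogPoly.zero (k : ℕ) : IsHomogPoly 𝕜 k (fun _ : V => (0 : E)) :=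
  ⟨0, fun _ => rfl⟩

theorem IsHomogPoly.const (c : E) : IsHomogPoly 𝕜 0 (fun _ : V => c) :=
  ⟨MultilinearMap.constOfIsEmpty 𝕜 _ c, fun _ => rfl⟩

theorem IsHomogPoly.linear (f : V →ₗ[𝕜] E) : IsHomogPoly 𝕜 1 (fun p : V => f p) :=
  ⟨MultilinearMap.ofSubsingleton 𝕜 V E (0 : Fin 1) f, fun _ => rfl⟩

theorem IsHomogPoly.add {k : ℕ} {f g : V → E} (hf : IsHomogPoly 𝕜 k f) (hg : IsHomogPoly 𝕜 k g) :
    IsHomogPoly 𝕜 k (fun p => f p + g p) := by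
  obtain ⟨M, hM⟩ := hf
  obtain ⟨N, hN⟩ := hg
  exact ⟨M + N, fun p => by simp [hM, hN]⟩

theorem IsHomogPoly.comp {k : ℕ} {f : V → E} (hf : IsHomogPoly 𝕜 k f) (g : E →ₗ[𝕜] F) :
    IsHomogPoly 𝕜 k (fun p => g (f p)) := by
  obtain ⟨M, hM⟩ := hf
  exact ⟨g.compMultilinearMap M, fun p => by simp [hM]⟩

theorem IsHomogPoly.sub {k : ℕ} {f g : V → E} (hf : IsHomogPoly 𝕜 k f) (hg : IsHomogPoly 𝕜 k g) :
    IsHomogPoly 𝕜 k (fun p => f p - g p) := by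
  obtain ⟨M, hM⟩ := hf
  obtain ⟨N, hN⟩ := hg
  exact ⟨M - N, fun p => by simp [hM, hN]⟩

theorem IsHomogPoly.sum {k : ℕ} {ι : Type*} (t : Finset ι) {f : ι → V → E}
    (hf : ∀ j ∈ t, IsHomogPoly 𝕜 k (f j)) : IsHomogPoly 𝕜 k (fun p => ∑ j ∈ t, f j p) := by
  classical
  induction t using Finset.induction_on with
  | empty => simpa using IsHomogPoly.zero k
  | insert a t ha ih =>
    simp only [Finset.sum_insert ha]
    exact (hf a (by simp)).add (ih fun j hj => hf j (by simp [hj]))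

theorem IsHomogPoly.bilin {a b : ℕ} {f : V → E} {g : V → F} (hf : IsHomogPoly 𝕜 a f)
    (hg : IsHomogPoly 𝕜 b g) (B : E →ₗ[𝕜] F →ₗ[𝕜] H) :
    IsHomogPoly 𝕜 (a + b) (fun p => B (f p) (g p)) := by
  obtain ⟨M, hM⟩ := hf
  obtain ⟨N, hN⟩ := hg
  refine ⟨(TensorProduct.lift B).compMultilinearMap
    ((M.domCoprod N).domDomCongr finSumFinEquiv), fun p => ?_⟩
  simp [hM, hN, MultilinearMap.domCoprod_apply]

theorem IsHomogPoly.map_smul {k : ℕ} {f : V → E} (hf : IsHomogPoly 𝕜 k f) (c : 𝕜) (p : V) :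
    f (c • p) = c ^ k • f p := by
  obtain ⟨M, hM⟩ := hf
  rw [hM, hM]
  simpa using M.map_smul_univ (fun _ => c) (fun _ => p)

end Homog

/-! ### The canonical `ℓ`-matrix -/

section Formal

variable {𝕜 : Type u} [RCLike 𝕜] {𝔩 : Type v} [LieRing 𝔩] [LieAlgebra 𝕜 𝔩]
  {𝔤 : Type w} [LieRing 𝔤] [LieAlgebra 𝕜 𝔤]

/-- `⟨η, d_p f(α) ξ⟩` for a map `f` with values in the linear maps `𝔤* → 𝔤`. -/
def dirDeriv (f : Dual 𝕜 𝔩 → Dual 𝕜 𝔤 →ₗ[𝕜] 𝔤) (p α : Dual 𝕜 𝔩) (ξ η : Dual 𝕜 𝔤) : 𝕜 :=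
  deriv (fun t : 𝕜 => η (f (p + t • α) ξ)) 0

/-- Formal maps from (the formal neighbourhood of `0` in) `𝔩*` to the linear maps `𝔤* → 𝔤`. -/
abbrev FormalL (𝕜 : Type u) [RCLike 𝕜] (𝔩 : Type v) [LieRing 𝔩] [LieAlgebra 𝕜 𝔩]
    (𝔤 : Type w) [LieRing 𝔤] [LieAlgebra 𝕜 𝔤] :=
  FormalMap 𝕜 (Dual 𝕜 𝔩) (Dual 𝕜 𝔤 →ₗ[𝕜] 𝔤)

/-- The formal map `p ↦ ψ ∘ l_p ∘ ψ*`. -/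
def FormalMap.conj {𝔤' : Type*} [LieRing 𝔤'] [LieAlgebra 𝕜 𝔤'] (ψ : 𝔤 →ₗ[𝕜] 𝔤')
    (l : FormalL 𝕜 𝔩 𝔤) : FormalL 𝕜 𝔩 𝔤' where
  term k p := Bidyn.conj ψ (l.term k p)
  isHomogPoly k := (l.isHomogPoly k).comp (Bidyn.conj ψ)

namespace BidynLQB

variable (𝓖 : BidynLQB 𝕜 𝔩 𝔤)

/-- The degree `k` term of `ζ ↦ l_p ζ + ζ ∈ 𝔡`. -/
def tauTerm (l : ℕ → Dual 𝕜 𝔩 → Dual 𝕜 𝔤 →ₗ[𝕜] 𝔤) (k : ℕ) (p : Dual 𝕜 𝔩) :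
    Dual 𝕜 𝔤 →ₗ[𝕜] 𝔤 × Dual 𝕜 𝔤 :=
  LinearMap.prod (l k p) (if k = 0 then LinearMap.id else 0)

/-- The degree `k` term of `ζ ↦ ad_{sp} (l_p ζ + ζ) ∈ 𝔡`. -/
def adTauTerm (l : ℕ → Dual 𝕜 𝔩 → Dual 𝕜 𝔤 →ₗ[𝕜] 𝔤) :
    ℕ → Dual 𝕜 𝔩 → Dual 𝕜 𝔤 →ₗ[𝕜] 𝔤 × Dual 𝕜 𝔤
  | 0, _ => 0
  | k + 1, p => 𝓖.doubleBracket (0, 𝓖.s p) ∘ₗ tauTerm l k p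

/-- The degree `k` term of `ζ ↦ ζ̃_p = p_{𝔤*} ad_{sp} (l_p ζ + ζ)`. -/
def tildeTerm (l : ℕ → Dual 𝕜 𝔩 → Dual 𝕜 𝔤 →ₗ[𝕜] 𝔤) (k : ℕ) (p : Dual 𝕜 𝔩) :
    Dual 𝕜 𝔤 →ₗ[𝕜] Dual 𝕜 𝔤 :=
  LinearMap.snd 𝕜 𝔤 (Dual 𝕜 𝔤) ∘ₗ 𝓖.adTauTerm l k p

/-- The degree `k` term of `ζ ↦ ad_{sp} (l_p ζ + ζ) - (l_p ζ̃_p + ζ̃_p)`; this is an element of `𝔤`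
since `ζ̃_p` is the component in `𝔤*` of the first summand. -/
def rhsTerm (l : ℕ → Dual 𝕜 𝔩 → Dual 𝕜 𝔤 →ₗ[𝕜] 𝔤) (k : ℕ) (p : Dual 𝕜 𝔩) :
    Dual 𝕜 𝔤 →ₗ[𝕜] 𝔤 :=
  LinearMap.fst 𝕜 𝔤 (Dual 𝕜 𝔤) ∘ₗ 𝓖.adTauTerm l k p -
    ∑ ab ∈ Finset.HasAntidiagonal.antidiagonal k, l ab.1 p ∘ₗ 𝓖.tildeTerm l ab.2 p

/-- `l` is a formal solution, with `l₀ = 0`, of the differential equation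
`d_p l(p) ζ = ad_{sp} (l_p ζ + ζ) - (l_p ζ̃_p + ζ̃_p) - p_𝔩 l_p ζ - l_p s i* ζ` for all `ζ ∈ 𝔤*`. -/
structure IsCanonical (l : FormalL 𝕜 𝔩 𝔤) : Prop where
  zero : ∀ p, l.term 0 p = 0
  diffeq : ∀ k p ζ η, dirDeriv (l.term k) p p ζ η =
    η (𝓖.rhsTerm l.term k p ζ - 𝓖.i (𝓖.projL (l.term k p ζ)) - l.term k p (𝓖.s (𝓖.iT ζ)))

end BidynLQB

theorem dirDeriv_self {k : ℕ} {f : Dual 𝕜 𝔩 → Dual 𝕜 𝔤 →ₗ[𝕜] 𝔤} (hf : IsHomogPoly 𝕜 k f)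
    (p : Dual 𝕜 𝔩) (ξ η : Dual 𝕜 𝔤) : dirDeriv f p p ξ η = (k : 𝕜) * η (f p ξ) := by
  have h : (fun t : 𝕜 => η (f (p + t • p) ξ)) = fun t => (1 + t) ^ k * η (f p ξ) := by
    funext t
    have : p + t • p = (1 + t) • p := by rw [add_smul, one_smul]
    rw [this, hf.map_smul]
    simp
  have h2 : HasDerivAt (fun t : 𝕜 => (1 + t) ^ k * η (f p ξ))
      ((k : 𝕜) * η (f p ξ)) 0 := by
    have h3 : HasDerivAt (fun t : 𝕜 => (1 + t) ^ k) (k : 𝕜) 0 := by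
      simpa using! ((hasDerivAt_id (0 : 𝕜)).const_add 1).pow k
    exact h3.mul_const _
  rw [dirDeriv, h, h2.deriv]

namespace BidynLQB

variable (𝓖 : BidynLQB 𝕜 𝔩 𝔤)

theorem adTauTerm_congr {l l' : ℕ → Dual 𝕜 𝔩 → Dual 𝕜 𝔤 →ₗ[𝕜] 𝔤} {k : ℕ} (p : Dual 𝕜 𝔩)
    (h : ∀ j < k, l j p = l' j p) : 𝓖.adTauTerm l k p = 𝓖.adTauTerm l' k p := by
  cases k with
  | zero => rfl
  | succ k => simp [adTauTerm, tauTerm, h k (Nat.lt_succ_self k)]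

theorem rhsTerm_congr {l l' : ℕ → Dual 𝕜 𝔩 → Dual 𝕜 𝔤 →ₗ[𝕜] 𝔤} {k : ℕ} (p : Dual 𝕜 𝔩)
    (h : ∀ j < k, l j p = l' j p) : 𝓖.rhsTerm l k p = 𝓖.rhsTerm l' k p := by
  rw [rhsTerm, rhsTerm, 𝓖.adTauTerm_congr p h]
  congr 1
  refine Finset.sum_congr rfl fun ab hab => ?_
  have hab' := Finset.HasAntidiagonal.mem_antidiagonal.1 hab
  rcases Nat.eq_zero_or_pos ab.2 with h0 | h0
  · simp [tildeTerm, h0, adTauTerm]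
  · rw [h ab.1 (by omega), tildeTerm, tildeTerm,
      𝓖.adTauTerm_congr p fun j hj => h j (by omega)]

theorem isHomogPoly_adTauTerm {l : ℕ → Dual 𝕜 𝔩 → Dual 𝕜 𝔤 →ₗ[𝕜] 𝔤} {k : ℕ}
    (h : ∀ j < k, IsHomogPoly 𝕜 j (l j)) : IsHomogPoly 𝕜 k (𝓖.adTauTerm l k) := by
  cases k with
  | zero => exact IsHomogPoly.zero 0
  | succ k =>
    have h1 : IsHomogPoly 𝕜 k (tauTerm l k) := by
      have h2 := (h k (Nat.lt_succ_self k)).comp (F := Dual 𝕜 𝔤 →ₗ[𝕜] 𝔤 × Dual 𝕜 𝔤)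
        (LinearMap.llcomp 𝕜 (Dual 𝕜 𝔤) 𝔤 (𝔤 × Dual 𝕜 𝔤) (LinearMap.inl 𝕜 𝔤 (Dual 𝕜 𝔤)))
      have h3 : IsHomogPoly 𝕜 k (fun _ : Dual 𝕜 𝔩 =>
          LinearMap.inr 𝕜 𝔤 (Dual 𝕜 𝔤) ∘ₗ
            (if k = 0 then LinearMap.id else 0 : Dual 𝕜 𝔤 →ₗ[𝕜] Dual 𝕜 𝔤)) := by
        rcases Nat.eq_zero_or_pos k with h0 | h0
        · subst h0
          exact IsHomogPoly.const _
        · simpa [h0.ne'] using IsHomogPoly.zero k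
      convert! h2.add h3 using 1
      funext p
      ext ξ <;> simp [tauTerm]
    have h4 := (IsHomogPoly.linear (𝕜 := 𝕜)
      (𝓖.doubleBracket ∘ₗ LinearMap.inr 𝕜 𝔤 (Dual 𝕜 𝔤) ∘ₗ 𝓖.s)).bilin
      (E := (𝔤 × Dual 𝕜 𝔤) →ₗ[𝕜] 𝔤 × Dual 𝕜 𝔤) (H := Dual 𝕜 𝔤 →ₗ[𝕜] 𝔤 × Dual 𝕜 𝔤) h1
      (LinearMap.llcomp 𝕜 (Dual 𝕜 𝔤) (𝔤 × Dual 𝕜 𝔤) (𝔤 × Dual 𝕜 𝔤))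
    rw [add_comm 1 k] at h4
    exact h4

theorem isHomogPoly_rhsTerm {l : ℕ → Dual 𝕜 𝔩 → Dual 𝕜 𝔤 →ₗ[𝕜] 𝔤} {k : ℕ}
    (h : ∀ j ≤ k, IsHomogPoly 𝕜 j (l j)) : IsHomogPoly 𝕜 k (𝓖.rhsTerm l k) := by
  refine ((𝓖.isHomogPoly_adTauTerm fun j hj => h j hj.le).comp (F := Dual 𝕜 𝔤 →ₗ[𝕜] 𝔤)
    (LinearMap.llcomp 𝕜 (Dual 𝕜 𝔤) (𝔤 × Dual 𝕜 𝔤) 𝔤 (LinearMap.fst 𝕜 𝔤 (Dual 𝕜 𝔤)))).sub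
    (IsHomogPoly.sum _ fun ab hab => ?_)
  have hab' := Finset.HasAntidiagonal.mem_antidiagonal.1 hab
  have h1 := (𝓖.isHomogPoly_adTauTerm (k := ab.2) fun j hj => h j (by omega)).comp
    (F := Dual 𝕜 𝔤 →ₗ[𝕜] Dual 𝕜 𝔤)
    (LinearMap.llcomp 𝕜 (Dual 𝕜 𝔤) (𝔤 × Dual 𝕜 𝔤) (Dual 𝕜 𝔤) (LinearMap.snd 𝕜 𝔤 (Dual 𝕜 𝔤)))
  have h2 := (h ab.1 (by omega)).bilin (H := Dual 𝕜 𝔤 →ₗ[𝕜] 𝔤) h1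
    (LinearMap.llcomp 𝕜 (Dual 𝕜 𝔤) (Dual 𝕜 𝔤) 𝔤)
  rw [hab'] at h2
  exact h2

/-- The projection of `𝔤` onto `i(𝔩)`. -/
def P : 𝔤 →ₗ[𝕜] 𝔤 := 𝓖.iLin ∘ₗ 𝓖.projL

theorem P_P (x : 𝔤) : 𝓖.P (𝓖.P x) = 𝓖.P x := by
  simp only [P, projL, iLin, LinearMap.comp_apply]
  rw [LinearMap.linearProjOfIsCompl_apply_left]

theorem s_iT (ζ : Dual 𝕜 𝔤) : 𝓖.s (𝓖.iT ζ) = ζ ∘ₗ 𝓖.P := rfl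

theorem s_iT_s_iT (ζ : Dual 𝕜 𝔤) : 𝓖.s (𝓖.iT (𝓖.s (𝓖.iT ζ))) = 𝓖.s (𝓖.iT ζ) := by
  rw [s_iT, s_iT]
  ext x
  simp [P_P]

/-- Inverse of the operator `X ↦ k X + P X + X P*`. -/
def solve (k : ℕ) : (Dual 𝕜 𝔤 →ₗ[𝕜] 𝔤) →ₗ[𝕜] (Dual 𝕜 𝔤 →ₗ[𝕜] 𝔤) :=
  let A := LinearMap.llcomp 𝕜 (Dual 𝕜 𝔤) 𝔤 𝔤 𝓖.P
  let B := LinearMap.lcomp 𝕜 𝔤 (𝓖.s ∘ₗ 𝓖.iT)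
  (k : 𝕜)⁻¹ • (LinearMap.id - A - B + A ∘ₗ B) +
    ((k : 𝕜) + 1)⁻¹ • (A + B - (2 : 𝕜) • A ∘ₗ B) + ((k : 𝕜) + 2)⁻¹ • A ∘ₗ B

theorem solve_spec {k : ℕ} (hk : k ≠ 0) (X Y : Dual 𝕜 𝔤 →ₗ[𝕜] 𝔤) :
    (∀ ζ, (k : 𝕜) • X ζ = Y ζ - 𝓖.P (X ζ) - X (𝓖.s (𝓖.iT ζ))) ↔ X = 𝓖.solve k Y := by
  have h0 : (k : 𝕜) ≠ 0 := by exact_mod_cast hk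
  have h1 : (k : 𝕜) + 1 ≠ 0 := by exact_mod_cast Nat.succ_ne_zero k
  have h2 : (k : 𝕜) + 2 ≠ 0 := by exact_mod_cast Nat.succ_ne_zero (k + 1)
  constructor
  · intro h
    have hY : ∀ ζ, Y ζ = (k : 𝕜) • X ζ + 𝓖.P (X ζ) + X (𝓖.s (𝓖.iT ζ)) := by
      intro ζ
      rw [h ζ]
      abel
    ext ζ
    simp only [solve, LinearMap.add_apply, LinearMap.sub_apply, LinearMap.smul_apply,
      LinearMap.comp_apply, LinearMap.llcomp_apply, LinearMap.lcomp_apply, LinearMap.id_apply, hY,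
      map_add, map_smul, P_P, s_iT_s_iT]
    match_scalars <;> field_simp <;> ring
  · rintro rfl ζ
    simp only [solve, LinearMap.add_apply, LinearMap.sub_apply, LinearMap.smul_apply,
      LinearMap.comp_apply, LinearMap.llcomp_apply, LinearMap.lcomp_apply, LinearMap.id_apply,
      map_add, map_sub, map_smul, P_P, s_iT_s_iT]
    match_scalars <;> field_simp <;> ring

theorem isCanonical_iff (l : FormalL 𝕜 𝔩 𝔤) :
    𝓖.IsCanonical l ↔ (∀ p, l.term 0 p = 0) ∧
      ∀ k, k ≠ 0 → ∀ p, l.term k p = 𝓖.solve k (𝓖.rhsTerm l.term k p) := by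
  constructor
  · rintro ⟨h0, h⟩
    refine ⟨h0, fun k hk p => (𝓖.solve_spec hk _ _).1 fun ζ => ?_⟩
    refine Module.eval_apply_injective 𝕜 (LinearMap.ext fun η => ?_)
    simp only [Module.Dual.eval_apply]
    have := h k p ζ η
    rw [dirDeriv_self (l.isHomogPoly k)] at this
    rw [map_smul, smul_eq_mul, this]
    rfl
  · rintro ⟨h0, h⟩
    refine ⟨h0, fun k p ζ η => ?_⟩
    rw [dirDeriv_self (l.isHomogPoly k)]
    rcases eq_or_ne k 0 with rfl | hk
    · simp [h0, rhsTerm, adTauTerm]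
    · have := (𝓖.solve_spec hk _ _).2 (h k hk p) ζ
      rw [← smul_eq_mul, ← map_smul, this]
      rfl

/-- The terms of the canonical `ℓ`-matrix, by recursion on the degree. -/
def canTerm : ℕ → Dual 𝕜 𝔩 → Dual 𝕜 𝔤 →ₗ[𝕜] 𝔤
  | 0 => 0
  | k + 1 => fun p =>
    𝓖.solve (k + 1) (𝓖.rhsTerm (fun j => if _h : j < k + 1 then canTerm j else 0) (k + 1) p)

theorem canTerm_eq {k : ℕ} (hk : k ≠ 0) (p : Dual 𝕜 𝔩) :
    𝓖.canTerm k p = 𝓖.solve k (𝓖.rhsTerm 𝓖.canTerm k p) := by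
  cases k with
  | zero => exact absurd rfl hk
  | succ k =>
    rw [canTerm]
    beta_reduce
    rw [𝓖.rhsTerm_congr (l' := 𝓖.canTerm) p fun j hj => by simp [hj]]

theorem isHomogPoly_canTerm (k : ℕ) : IsHomogPoly 𝕜 k (𝓖.canTerm k) := by
  induction k using Nat.strong_induction_on with
  | _ k ih =>
    rcases eq_or_ne k 0 with rfl | hk
    · rw [canTerm]
      exact IsHomogPoly.zero 0
    · let t : ℕ → Dual 𝕜 𝔩 → Dual 𝕜 𝔤 →ₗ[𝕜] 𝔤 := fun j => if j < k then 𝓖.canTerm j else 0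
      have ht : ∀ j ≤ k, IsHomogPoly 𝕜 j (t j) := by
        intro j _
        by_cases hj : j < k
        · simpa [t, hj] using ih j hj
        · simpa [t, hj] using! IsHomogPoly.zero j
      have h := (𝓖.isHomogPoly_rhsTerm ht).comp (𝓖.solve k)
      convert! h using 1
      funext p
      rw [𝓖.canTerm_eq hk p]
      congr 1
      refine 𝓖.rhsTerm_congr p fun j hj => ?_
      simp [t, hj]

/-- The differential equation has exactly one formal solution vanishing at `0`. -/
theorem existsUnique_isCanonical : ∃! l : FormalL 𝕜 𝔩 𝔤, 𝓖.IsCanonical l := by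
  refine ⟨⟨𝓖.canTerm, 𝓖.isHomogPoly_canTerm⟩,
    (𝓖.isCanonical_iff _).2 ⟨fun p => by simp [canTerm], fun k hk p => 𝓖.canTerm_eq hk p⟩, ?_⟩
  intro l hl
  obtain ⟨h0, h⟩ := (𝓖.isCanonical_iff _).1 hl
  ext1
  funext k
  induction k using Nat.strong_induction_on with
  | _ k ih =>
    funext p
    rcases eq_or_ne k 0 with rfl | hk
    · simp [h0, canTerm]
    · change _ = 𝓖.canTerm k p
      rw [h k hk, 𝓖.canTerm_eq hk]
      congr 1
      exact 𝓖.rhsTerm_congr p fun j hj => by rw [ih j hj]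

/-- The canonical `ℓ`-matrix associated with `𝓖` and its reductive decomposition. -/
def lcan : FormalL 𝕜 𝔩 𝔤 := 𝓖.existsUnique_isCanonical.choose

theorem isCanonical_lcan : 𝓖.IsCanonical 𝓖.lcan := 𝓖.existsUnique_isCanonical.choose_spec.1

/-- `l` is a formal dynamical `ℓ`-matrix associated with `𝓖`: it takes values in `⋀²𝔤` and satisfies,
degree by degree, the classical dynamical Yang-Baxter equation
`↻ (⟨ζ, d_p l(i* ξ) η⟩ - ⟨ζ, [l_p ξ, l_p η]⟩ - ⟨ζ, ϖ_{l_p ξ} η⟩) = ⟨ξ ⊗ η ⊗ ζ, φ⟩`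
and the equivariance `d_p l(ad*_z p) + ϖ_z + ad_z l_p + l_p ad*_z = 0`. -/
structure IsDynamical (l : FormalL 𝕜 𝔩 𝔤) : Prop where
  skew : ∀ k p (ξ η : Dual 𝕜 𝔤), η (l.term k p ξ) = -ξ (l.term k p η)
  cdybe : ∀ k p (ξ η ζ : Dual 𝕜 𝔤),
    cycl (fun ξ η ζ => dirDeriv (l.term (k + 1)) p (𝓖.iT ξ) η ζ
      - ζ (∑ ab ∈ Finset.HasAntidiagonal.antidiagonal k, ⁅l.term ab.1 p ξ, l.term ab.2 p η⁆)
      - ζ (𝓖.ϖ (l.term k p ξ) η)) ξ η ζ = if k = 0 then ζ (𝓖.φ ξ η) else 0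
  equivariant : ∀ k p (z : 𝔩) (ξ η : Dual 𝕜 𝔤),
    dirDeriv (l.term k) p (adT z p) ξ η + (if k = 0 then η (𝓖.ϖ (𝓖.i z) ξ) else 0)
      + η ⁅𝓖.i z, l.term k p ξ⁆ + η (l.term k p (adT (𝓖.i z) ξ)) = 0

/-- The conditions `l₀ = 0` and `l_p s p = 0`. -/
structure IsNormalized (l : FormalL 𝕜 𝔩 𝔤) : Prop where
  zero : ∀ p, l.term 0 p = 0
  apply_s : ∀ k p, l.term k p (𝓖.s p) = 0

end BidynLQB

end Formal

/-! ### Dynamical brackets on the trivial groupoid `U × G × U` -/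

section Groupoid

/-- A norm on the finite-dimensional space `V*` (all norms are equivalent), giving it its usual
topology and smooth structure. -/
instance dualNormedAddCommGroup (V : Type*) [AddCommGroup V] [Module ℝ V] [FiniteDimensional ℝ V] :
    NormedAddCommGroup (Dual ℝ V) :=
  NormedAddCommGroup.induced (Dual ℝ V) _ (Module.finBasis ℝ (Dual ℝ V)).equivFun
    (Module.finBasis ℝ (Dual ℝ V)).equivFun.injective

instance dualNormedSpace (V : Type*) [AddCommGroup V] [Module ℝ V] [FiniteDimensional ℝ V] :
    NormedSpace ℝ (Dual ℝ V) :=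
  NormedSpace.induced ℝ (Dual ℝ V) _ (Module.finBasis ℝ (Dual ℝ V)).equivFun

instance completeSpace_of_finiteDimensional {E : Type*} [NormedAddCommGroup E] [NormedSpace ℝ E]
    [FiniteDimensional ℝ E] : CompleteSpace E :=
  FiniteDimensional.complete ℝ E

instance lieGroup_minSmoothness {E : Type*} [NormedAddCommGroup E] [NormedSpace ℝ E]
    {G : Type*} [TopologicalSpace G] [ChartedSpace E G] [Group G] [LieGroup 𝓘(ℝ, E) ∞ G] :
    LieGroup 𝓘(ℝ, E) (minSmoothness ℝ 3) G := by
  rw [minSmoothness_of_isRCLikeNormedField]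
  infer_instance

variable {𝔩 : Type*} [LieRing 𝔩] [LieAlgebra ℝ 𝔩] [FiniteDimensional ℝ 𝔩]

/-- The map `l`, restricted to the open set `U`, is analytic with values in the linear maps
`𝔤* → 𝔤`, and its Taylor expansion at `0` is the formal map `lf`. -/
structure Realizes {𝔤 : Type*} [LieRing 𝔤] [LieAlgebra ℝ 𝔤]
    (U : TopologicalSpace.Opens (Dual ℝ 𝔩)) (l : Dual ℝ 𝔩 → Dual ℝ 𝔤 →ₗ[ℝ] 𝔤)
    (lf : FormalL ℝ 𝔩 𝔤) : Prop where
  analytic : ∀ ξ η : Dual ℝ 𝔤, AnalyticOnNhd ℝ (fun p => η (l p ξ)) U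
  taylor : ∀ ξ η : Dual ℝ 𝔤, ∀ᶠ p in 𝓝 (0 : Dual ℝ 𝔩),
    HasSum (fun k => η (lf.term k p ξ)) (η (l p ξ))

variable {E : Type*} [NormedAddCommGroup E] [NormedSpace ℝ E] [FiniteDimensional ℝ E]
  {G : Type*} [TopologicalSpace G] [ChartedSpace E G] [Group G] [LieGroup 𝓘(ℝ, E) ∞ G]

/-- The Lie algebra of a Lie group modelled on `E`. -/
abbrev LieAlg (E : Type*) [NormedAddCommGroup E] [NormedSpace ℝ E]
    (G : Type*) [TopologicalSpace G] [ChartedSpace E G] [Group G] : Type _ :=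
  GroupLieAlgebra 𝓘(ℝ, E) G

/-- The right derivative `⟨D_x f, u⟩ = d/dt f(exp(tu) x)` at `t = 0`. -/
def rightD (f : G → ℝ) (x : G) : Dual ℝ (LieAlg E G) :=
  (mfderiv 𝓘(ℝ, E) 𝓘(ℝ, ℝ) (fun y => f (y * x)) 1).toLinearMap

/-- The left derivative `⟨D'_x f, u⟩ = d/dt f(x exp(tu))` at `t = 0`. -/
def leftD (f : G → ℝ) (x : G) : Dual ℝ (LieAlg E G) :=
  (mfderiv 𝓘(ℝ, E) 𝓘(ℝ, ℝ) (fun y => f (x * y)) 1).toLinearMap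

/-- The adjoint action `Ad_x` on the Lie algebra of `G`. -/
def Ad (x : G) : LieAlg E G →ₗ[ℝ] LieAlg E G :=
  (mfderiv 𝓘(ℝ, E) 𝓘(ℝ, E) (fun y => x * y * x⁻¹) 1).toLinearMap

/-- The tangent map at `1` of a map `ψ` between Lie groups with `ψ 1 = 1`. -/
def tangentOne {E' : Type*} [NormedAddCommGroup E'] [NormedSpace ℝ E']
    {G' : Type*} [TopologicalSpace G'] [ChartedSpace E' G'] [Group G']
    (ψ : G → G') : LieAlg E G →ₗ[ℝ] LieAlg E' G' :=
  (mfderiv 𝓘(ℝ, E) 𝓘(ℝ, E') ψ 1).toLinearMap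

/-- `π : G → ⋀²𝔤` is a smooth group `1`-cocycle integrating the Lie algebra cocycle `ϖ`. -/
structure IntegratesCocycle (π : G → Dual ℝ (LieAlg E G) →ₗ[ℝ] LieAlg E G)
    (ϖ : LieAlg E G →ₗ[ℝ] Dual ℝ (LieAlg E G) →ₗ[ℝ] LieAlg E G) : Prop where
  skew : ∀ x (ξ η : Dual ℝ (LieAlg E G)), η (π x ξ) = -ξ (π x η)
  smooth : ∀ ξ η : Dual ℝ (LieAlg E G), ContMDiff 𝓘(ℝ, E) 𝓘(ℝ, ℝ) ∞ fun x => η (π x ξ)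
  cocycle : ∀ x y, π (x * y) = π x + conj (Ad x) (π y)
  tangent : ∀ (ξ η : Dual ℝ (LieAlg E G)) (u : LieAlg E G),
    rightD (fun x => η (π x ξ)) 1 u = η (ϖ u ξ)

/-- The derivative of a function on the open set `U ⊆ 𝔩*`, seen as an element of `𝔩 = 𝔩**`. -/
def baseD {U : TopologicalSpace.Opens (Dual ℝ 𝔩)} (f : U → ℝ) (p : U) : 𝔩 :=
  (Module.evalEquiv ℝ 𝔩).symm
    (mfderiv 𝓘(ℝ, Dual ℝ 𝔩) 𝓘(ℝ, ℝ) f p).toLinearMap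

/-- The dynamical bracket on `U × G × U` defined by `l : U → ⋀²𝔤` and `π : G → ⋀²𝔤`. -/
def dynBracket (𝓖 : BidynLQB ℝ 𝔩 (LieAlg E G)) (U : TopologicalSpace.Opens (Dual ℝ 𝔩))
    (l : Dual ℝ 𝔩 → Dual ℝ (LieAlg E G) →ₗ[ℝ] LieAlg E G)
    (π : G → Dual ℝ (LieAlg E G) →ₗ[ℝ] LieAlg E G) (f g : U × G × U → ℝ) : U × G × U → ℝ :=
  fun (p, x, q) =>
    let δ (h : U × G × U → ℝ) : 𝔩 := baseD (fun p' => h (p', x, q)) p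
    let δ' (h : U × G × U → ℝ) : 𝔩 := baseD (fun q' => h (p, x, q')) q
    let D (h : U × G × U → ℝ) : Dual ℝ (LieAlg E G) := rightD (fun x' => h (p, x', q)) x
    let D' (h : U × G × U → ℝ) : Dual ℝ (LieAlg E G) := leftD (fun x' => h (p, x', q)) x
    (p : Dual ℝ 𝔩) ⁅δ f, δ g⁆ - (q : Dual ℝ 𝔩) ⁅δ' f, δ' g⁆
      - D g (𝓖.i (δ f)) - D' g (𝓖.i (δ' f))
      + D f (𝓖.i (δ g)) + D' f (𝓖.i (δ' g))
      - D f (l p (D g)) + D f (π x (D g)) + D' f (l q (D' g))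

/-- The model of the manifold `U × G × U`. -/
abbrev groupoidModel (𝔩 : Type*) [LieRing 𝔩] [LieAlgebra ℝ 𝔩] [FiniteDimensional ℝ 𝔩]
    (E : Type*) [NormedAddCommGroup E] [NormedSpace ℝ E] :=
  𝓘(ℝ, Dual ℝ 𝔩).prod (𝓘(ℝ, E).prod 𝓘(ℝ, Dual ℝ 𝔩))

/-- The partial multiplication `(p, x, q) (q, y, r) = (p, x y, r)` of the trivial groupoid. -/
def gpdMul {B : Type*} {K : Type*} [Mul K] (a b : B × K × B) (_h : a.2.2 = b.1) : B × K × B :=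
  (a.1, a.2.1 * b.2.1, b.2.2)

/-- `F : U × G × U → U × G' × U` is a morphism of Poisson groupoids covering the identity of `U`:
it is smooth, a morphism of groupoids, and a Poisson map for the brackets `b` and `b'`. -/
structure IsPoissonGroupoidMorphism {E' : Type*} [NormedAddCommGroup E'] [NormedSpace ℝ E']
    {G' : Type*} [TopologicalSpace G'] [ChartedSpace E' G'] [Group G']
    {U : TopologicalSpace.Opens (Dual ℝ 𝔩)}
    (b : (U × G × U → ℝ) → (U × G × U → ℝ) → U × G × U → ℝ)
    (b' : (U × G' × U → ℝ) → (U × G' × U → ℝ) → U × G' × U → ℝ)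
    (F : U × G × U → U × G' × U) : Prop where
  smooth : ContMDiff (groupoidModel 𝔩 E) (groupoidModel 𝔩 E') ∞ F
  source : ∀ a, (F a).1 = a.1
  target : ∀ a, (F a).2.2 = a.2.2
  unit : ∀ p, F (p, 1, p) = (p, 1, p)
  mul : ∀ a a' (h : a.2.2 = a'.1),
    F (gpdMul a a' h) = gpdMul (F a) (F a') (by rw [target, source, h])
  poisson : ∀ f g : U × G' × U → ℝ,
    ContMDiff (groupoidModel 𝔩 E') 𝓘(ℝ, ℝ) ∞ f → ContMDiff (groupoidModel 𝔩 E') 𝓘(ℝ, ℝ) ∞ g →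
    b (f ∘ F) (g ∘ F) = b' f g ∘ F

end Groupoid

end Bidyn

end

namespace Bidyn

universe u v w

/-! ### Directional derivatives of homogeneous terms. -/

section Homogeneous

variable {𝕜 : Type u} [RCLike 𝕜] {V : Type*} [AddCommGroup V] [Module 𝕜 V]

/-! The canonical equation is written with the double bracket by `s p`, the projection onto `𝔩`, `s`
and `i*`, and a morphism `υ` respects all of these: `υ` intertwines the projections, so `υ* s' = s`,
and `i* υ* = i'*`. Hence `υ l υ*` solves the equation of `𝓖'` when `l` solves that of `𝓖`
(`isCanonical_conj`). Solutions vanishing at `0` are unique: in degree `k` the left side is `k`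
times the term, and `k + P + P*` is invertible for `k ≥ 1`. So the canonical matrices correspond
(`conj_lcan`).

A normalized dynamical matrix is canonical because the Yang-Baxter equation with first argument `s
p` is the canonical equation (`IsDynamical.isCanonical`): the terms containing `l_p s p` vanish, and
differentiating `l_p s p = 0` turns the derivatives along `i*η` and `i*ζ` into the terms `l_p s i*`
and `p_𝔩 l_p`.

Over `ℝ`, the identity theorem extends the equality of Taylor expansions to `U` (`Realizes.eqOn`).
The difference of `υ π υ*` and `π' ∘ ψ` is a group cocycle with zero derivative at `1`, hence
everywhere, so it vanishes on the connected group `G` (`IntegratesCocycle.conj_eq`). Since `D (f ∘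
Ψ) = υ* D f`, and likewise for `D'`, the brackets match term by term (`dynBracket_comp`). -/

theorem IsHomogPoly.differentiable_line {k : ℕ} {f : V → 𝕜} (hf : IsHomogPoly 𝕜 k f) (p α : V) :
    Differentiable 𝕜 fun t : 𝕜 => f (p + t • α) := by
  classical
  obtain ⟨M, hM⟩ := hf
  -- Multilinear expansion, where `S` is the set of slots receiving `p`; the result is a polynomial
  -- in `t`.
  have h : (fun t : 𝕜 => f (p + t • α)) = fun t : 𝕜 => ∑ S : Finset (Fin k),
      t ^ Sᶜ.card * M (S.piecewise (fun _ => p) fun _ => α) := by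
    funext t
    rw [hM]
    change M ((fun _ => p) + fun _ => t • α) = _
    rw [M.map_add_univ]
    refine Finset.sum_congr rfl fun S _ => ?_
    have := M.map_piecewise_smul (fun _ => t) (S.piecewise (fun _ => p) fun _ => α) Sᶜ
    rw [Finset.prod_const, smul_eq_mul] at this
    rw [← this]
    congr 1
    funext j
    by_cases hj : j ∈ S <;> simp [hj]
  rw [h]
  fun_prop

end Homogeneous

section Formal

variable {𝕜 : Type u} [RCLike 𝕜] {𝔩 : Type v} [LieRing 𝔩] [LieAlgebra 𝕜 𝔩]
  {𝔤 : Type w} [LieRing 𝔤] [LieAlgebra 𝕜 𝔤]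

theorem differentiable_line_apply {k : ℕ} {f : Dual 𝕜 𝔩 → Dual 𝕜 𝔤 →ₗ[𝕜] 𝔤}
    (hf : IsHomogPoly 𝕜 k f) (p α : Dual 𝕜 𝔩) (ξ η : Dual 𝕜 𝔤) :
    Differentiable 𝕜 fun t : 𝕜 => η (f (p + t • α) ξ) :=
  (hf.comp (η ∘ₗ LinearMap.applyₗ ξ)).differentiable_line p α

theorem dirDeriv_skew {f : Dual 𝕜 𝔩 → Dual 𝕜 𝔤 →ₗ[𝕜] 𝔤}
    (hf : ∀ p (ξ η : Dual 𝕜 𝔤), η (f p ξ) = -ξ (f p η)) (p α : Dual 𝕜 𝔩) (ξ η : Dual 𝕜 𝔤) :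
    dirDeriv f p α ξ η = -dirDeriv f p α η ξ := by
  simp only [dirDeriv, hf _ ξ η]
  exact deriv.fun_neg

/-- Differentiating `f_p (s p) = 0` in the direction `α`. -/
theorem dirDeriv_apply_of_apply_eq_zero {k : ℕ} {f : Dual 𝕜 𝔩 → Dual 𝕜 𝔤 →ₗ[𝕜] 𝔤}
    (hf : IsHomogPoly 𝕜 k f) (s : Dual 𝕜 𝔩 →ₗ[𝕜] Dual 𝕜 𝔤) (h : ∀ p, f p (s p) = 0)
    (p α : Dual 𝕜 𝔩) (η : Dual 𝕜 𝔤) :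
    dirDeriv f p α (s p) η = -η (f p (s α)) := by
  -- Since `s p = s (p + t α) - t s α`, the hypothesis at `p + t α` leaves an explicit factor `t`;
  -- the product rule at `t = 0` then involves only the value of `f` at `p`.
  have h1 : (fun t : 𝕜 => η (f (p + t • α) (s p))) =
      fun t => -t * η (f (p + t • α) (s α)) := by
    funext t
    have h2 := congrArg η (h (p + t • α))
    simp only [map_add, map_smul, map_zero, smul_eq_mul] at h2
    linear_combination h2
  have h3 := (hasDerivAt_neg (0 : 𝕜)).mul
    (differentiable_line_apply hf p α (s α) η 0).hasDerivAt
  rw [dirDeriv, h1]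
  refine h3.deriv.trans ?_
  simp

namespace BidynLQB

/-! ### Normalized dynamical matrices are canonical. -/

section Canonical

variable (𝓖 : BidynLQB 𝕜 𝔩 𝔤)

@[simp]
theorem projL_i (z : 𝔩) : 𝓖.projL (𝓖.i z) = z :=
  LinearMap.linearProjOfIsCompl_apply_left _ _ 𝓖.i_injective 𝓖.isCompl z

theorem projL_of_mem_𝔪 {u : 𝔤} (hu : u ∈ 𝓖.𝔪) : 𝓖.projL u = 0 :=
  LinearMap.linearProjOfIsCompl_apply_right _ _ 𝓖.i_injective 𝓖.isCompl ⟨u, hu⟩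

theorem exists_eq_i_add (x : 𝔤) : ∃ z : 𝔩, ∃ u ∈ 𝓖.𝔪, x = 𝓖.i z + u := by
  have h : x ∈ LinearMap.range (𝓖.i : 𝔩 →ₗ[𝕜] 𝔤) ⊔ 𝓖.𝔪 := by
    rw [𝓖.isCompl.sup_eq_top]
    trivial
  obtain ⟨_, ⟨z, rfl⟩, u, hu, rfl⟩ := Submodule.mem_sup.1 h
  exact ⟨z, u, hu, rfl⟩

@[simp]
theorem iT_s (p : Dual 𝕜 𝔩) : 𝓖.iT (𝓖.s p) = p := by
  ext z
  exact congrArg p (𝓖.projL_i z)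

theorem s_iT_apply (ζ : Dual 𝕜 𝔤) (x : 𝔤) : 𝓖.s (𝓖.iT ζ) x = ζ (𝓖.i (𝓖.projL x)) := rfl

/-- Bracketing with `s p`, which is linear in `p`, raises the degree by one. The summand `ζ` of `l_p
ζ + ζ` has degree `0`, so `φ` enters only in total degree one. -/
theorem fst_adTauTerm_succ (l : ℕ → Dual 𝕜 𝔩 → Dual 𝕜 𝔤 →ₗ[𝕜] 𝔤) (k : ℕ) (p : Dual 𝕜 𝔩)
    (ζ : Dual 𝕜 𝔤) : (𝓖.adTauTerm l (k + 1) p ζ).1 =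
      -𝓖.ϖ (l k p ζ) (𝓖.s p) + if k = 0 then 𝓖.φ (𝓖.s p) ζ else 0 := by
  by_cases hk : k = 0 <;>
    simp [adTauTerm, tauTerm, LieQuasiBialgebra.doubleBracket, hk]

theorem snd_adTauTerm_succ (l : ℕ → Dual 𝕜 𝔩 → Dual 𝕜 𝔤 →ₗ[𝕜] 𝔤) (k : ℕ) (p : Dual 𝕜 𝔩)
    (ζ : Dual 𝕜 𝔤) (x : 𝔤) : (𝓖.adTauTerm l (k + 1) p ζ).2 x =
      𝓖.s p ⁅l k p ζ, x⁆ - if k = 0 then 𝓖.s p (𝓖.ϖ x ζ) else 0 := by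
  by_cases hk : k = 0 <;>
    simp [adTauTerm, tauTerm, LieQuasiBialgebra.doubleBracket, hk, adT]

/-- A normalized dynamical `ℓ`-matrix solves the differential equation of the canonical one:
this is the dynamical Yang-Baxter equation with first argument `s p`. -/
theorem IsDynamical.isCanonical {l : FormalL 𝕜 𝔩 𝔤} (hl : 𝓖.IsDynamical l)
    (hn : 𝓖.IsNormalized l) : 𝓖.IsCanonical l := by
  refine ⟨hn.zero, fun k p η ζ => ?_⟩
  cases k with
  | zero =>
    rw [dirDeriv_self (l.isHomogPoly 0)]
    simp [hn.zero, rhsTerm, adTauTerm]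
  | succ k =>
    have h := hl.cdybe k p (𝓖.s p) η ζ
    -- Of the bracket and `ϖ` terms, those with `s p` fed to `l` drop out; the derivative along `i*
    -- s p = p` is the left side of the canonical equation.
    simp only [cycl, hn.apply_s, zero_lie, lie_zero, map_zero, LinearMap.zero_apply,
      Finset.sum_const_zero, iT_s, sub_zero] at h
    have e1 : dirDeriv (l.term (k + 1)) p (𝓖.iT η) ζ (𝓖.s p) =
        ζ (l.term (k + 1) p (𝓖.s (𝓖.iT η))) := by
      rw [dirDeriv_skew (hl.skew (k + 1)),
        dirDeriv_apply_of_apply_eq_zero (l.isHomogPoly _) _ (hn.apply_s _), neg_neg]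
    have e2 : dirDeriv (l.term (k + 1)) p (𝓖.iT ζ) (𝓖.s p) η =
        ζ (𝓖.i (𝓖.projL (l.term (k + 1) p η))) := by
      rw [dirDeriv_apply_of_apply_eq_zero (l.isHomogPoly _) _ (hn.apply_s _), hl.skew, neg_neg,
        s_iT_apply]
    -- Skew-symmetry moves `l` from `ζ̃` onto the test functional, so the term quadratic in `l`
    -- becomes the bracket term of the Yang-Baxter equation paired with `s p`.
    have e3 : ζ (∑ ab ∈ Finset.HasAntidiagonal.antidiagonal (k + 1),
        l.term ab.1 p (𝓖.tildeTerm l.term ab.2 p η)) =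
        -𝓖.s p (∑ ab ∈ Finset.HasAntidiagonal.antidiagonal k, ⁅l.term ab.1 p η, l.term ab.2 p ζ⁆)
          + 𝓖.s p (𝓖.ϖ (l.term k p ζ) η) := by
      -- This isolates the pair `(k + 1, 0)`, whose contribution is zero because `adTauTerm`
      -- vanishes in degree `0`.
      rw [Finset.Nat.antidiagonal_succ', Finset.sum_cons, Finset.sum_map]
      simp only [tildeTerm, LinearMap.comp_apply, LinearMap.snd_apply, map_sum, map_add,
        Function.Embedding.prodMap, Function.Embedding.coeFn_mk, Prod.map,
        Function.Embedding.refl_apply]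
      simp only [hl.skew _ p _ ζ, Nat.succ_eq_add_one, snd_adTauTerm_succ]
      rw [← Finset.Nat.sum_antidiagonal_swap]
      simp only [Prod.fst_swap, Prod.snd_swap, Finset.sum_neg_distrib, Finset.sum_sub_distrib]
      -- The `ϖ` part of `ζ̃` lives in degree one only, which after the shift is the index `x.1 =
      -- 0`.
      have e : ∑ x ∈ Finset.HasAntidiagonal.antidiagonal k,
          (if x.1 = 0 then 𝓖.s p (𝓖.ϖ (l.term x.2 p ζ) η) else 0) =
            𝓖.s p (𝓖.ϖ (l.term k p ζ) η) := by
        rw [Finset.sum_eq_single (0, k)]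
        · simp
        · rintro ⟨a, b⟩ hab hne
          have hab : a + b = k := Finset.HasAntidiagonal.mem_antidiagonal.1 hab
          have : a ≠ 0 := by
            rintro rfl
            exact hne (by simpa using hab)
          simp [this]
        · intro h
          exact absurd (Finset.HasAntidiagonal.mem_antidiagonal.2 (zero_add k)) h
      rw [e]
      simp [adTauTerm]
      ring
    rw [e1, e2] at h
    simp only [rhsTerm, LinearMap.sub_apply, map_sub, LinearMap.comp_apply, LinearMap.fst_apply,
      LinearMap.sum_apply, e3, fst_adTauTerm_succ, map_add, map_neg]
    rw [𝓖.ϖ_skew _ (𝓖.s p) ζ]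
    rw [𝓖.ϖ_skew _ (𝓖.s p) η] at h
    have e4 : ζ (if k = 0 then 𝓖.φ (𝓖.s p) η else 0) =
        if k = 0 then ζ (𝓖.φ (𝓖.s p) η) else 0 := by
      split_ifs <;> simp
    rw [e4]
    linear_combination h

theorem IsCanonical.eq_lcan {l : FormalL 𝕜 𝔩 𝔤} (hl : 𝓖.IsCanonical l) : l = 𝓖.lcan :=
  𝓖.existsUnique_isCanonical.unique hl 𝓖.isCanonical_lcan

end Canonical

/-! ### Transport of formal matrices along a morphism. -/

namespace Hom

variable {𝔤' : Type*} [LieRing 𝔤'] [LieAlgebra 𝕜 𝔤'] {𝓖 : BidynLQB 𝕜 𝔩 𝔤} {𝓖' : BidynLQB 𝕜 𝔩 𝔤'}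
  (υ : 𝓖.Hom 𝓖')

/-- A morphism as a linear map. -/
abbrev lin : 𝔤 →ₗ[𝕜] 𝔤' := (υ.toLieHom : 𝔤 →ₗ[𝕜] 𝔤')

/-- Both summands of the reductive decomposition are preserved; dualizing gives `υ* s' = s`. -/
theorem projL_map (x : 𝔤) : 𝓖'.projL (υ.lin x) = 𝓖.projL x := by
  obtain ⟨z, u, hu, rfl⟩ := 𝓖.exists_eq_i_add x
  have h1 : υ.lin (𝓖.i z) = 𝓖'.i z := υ.map_i z
  rw [map_add, map_add, map_add, h1, projL_i, projL_i, 𝓖.projL_of_mem_𝔪 hu,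
    𝓖'.projL_of_mem_𝔪 (u := υ.lin u) (υ.map_𝔪 u hu)]

theorem dualMap_s (p : Dual 𝕜 𝔩) : υ.lin.dualMap (𝓖'.s p) = 𝓖.s p := by
  ext x
  exact congrArg p (υ.projL_map x)

theorem iT_dualMap (ξ : Dual 𝕜 𝔤') : 𝓖.iT (υ.lin.dualMap ξ) = 𝓖'.iT ξ := by
  ext z
  exact congrArg ξ (υ.map_i z)

theorem dualMap_adT (z : 𝔩) (ξ : Dual 𝕜 𝔤') :
    υ.lin.dualMap (adT (𝓖'.i z) ξ) = adT (𝓖.i z) (υ.lin.dualMap ξ) := by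
  ext x
  refine congrArg ξ ?_
  change ⁅𝓖'.i z, υ.toLieHom x⁆ = υ.toLieHom ⁅𝓖.i z, x⁆
  rw [LieHom.map_lie, υ.map_i]

theorem fst_adTauTerm (l : FormalL 𝕜 𝔩 𝔤) (k : ℕ) (p : Dual 𝕜 𝔩) (ζ : Dual 𝕜 𝔤') :
    (𝓖'.adTauTerm (l.conj υ.lin).term k p ζ).1 =
      υ.lin (𝓖.adTauTerm l.term k p (υ.lin.dualMap ζ)).1 := by
  cases k with
  | zero => simp [adTauTerm]
  | succ k =>
    have h1 := υ.map_ϖ (l.term k p (υ.lin.dualMap ζ)) (𝓖'.s p)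
    have h2 := υ.map_φ (𝓖'.s p) ζ
    rw [υ.dualMap_s] at h1 h2
    rw [fst_adTauTerm_succ, fst_adTauTerm_succ, map_add, map_neg]
    congr 1
    · exact congrArg Neg.neg h1.symm
    · split_ifs
      · exact h2.symm
      · simp

/-- The component in `𝔤*` transforms contravariantly, opposite to `fst_adTauTerm`. This is the
direction needed for the quadratic term, where `υ l υ*` is applied to `ζ̃`. -/
theorem snd_adTauTerm (l : FormalL 𝕜 𝔩 𝔤) (k : ℕ) (p : Dual 𝕜 𝔩) (ζ : Dual 𝕜 𝔤') :
    υ.lin.dualMap (𝓖'.adTauTerm (l.conj υ.lin).term k p ζ).2 =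
      (𝓖.adTauTerm l.term k p (υ.lin.dualMap ζ)).2 := by
  cases k with
  | zero => simp [adTauTerm]
  | succ k =>
    ext x
    rw [snd_adTauTerm_succ, ← υ.dualMap_s p, LinearMap.dualMap_apply, snd_adTauTerm_succ]
    congr 1
    · refine congrArg (𝓖'.s p) ?_
      exact (υ.toLieHom.map_lie _ _).symm
    · split_ifs
      · exact congrArg (𝓖'.s p) (υ.map_ϖ x ζ).symm
      · rfl

theorem rhsTerm_conj (l : FormalL 𝕜 𝔩 𝔤) (k : ℕ) (p : Dual 𝕜 𝔩) (ζ : Dual 𝕜 𝔤') :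
    𝓖'.rhsTerm (l.conj υ.lin).term k p ζ =
      υ.lin (𝓖.rhsTerm l.term k p (υ.lin.dualMap ζ)) := by
  simp only [rhsTerm, LinearMap.sub_apply, map_sub, LinearMap.comp_apply, LinearMap.fst_apply,
    LinearMap.sum_apply, map_sum]
  rw [υ.fst_adTauTerm]
  congr 1
  refine Finset.sum_congr rfl fun ab _ => ?_
  exact congrArg (fun ξ => υ.lin (l.term ab.1 p ξ)) (υ.snd_adTauTerm l ab.2 p ζ)

theorem isCanonical_conj {l : FormalL 𝕜 𝔩 𝔤} (hl : 𝓖.IsCanonical l) :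
    𝓖'.IsCanonical (l.conj υ.lin) := by
  refine ⟨fun p => ?_, fun k p ζ η => ?_⟩
  · change Bidyn.conj υ.lin (l.term 0 p) = 0
    rw [hl.zero, map_zero]
  -- The directional derivative of `υ l υ*` tested on `ζ, η` is by definition that of `l` tested on
  -- `υ* ζ, υ* η`.
  · have h : _ = _ := hl.diffeq k p (υ.lin.dualMap ζ) (υ.lin.dualMap η)
    refine h.trans ?_
    change η (υ.lin _) = _
    have e1 : υ.lin (𝓖.i (𝓖.projL (l.term k p (υ.lin.dualMap ζ)))) =
        𝓖'.i (𝓖'.projL ((l.conj υ.lin).term k p ζ)) := by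
      rw [← υ.projL_map]
      exact υ.map_i _
    have e2 : υ.lin (l.term k p (𝓖.s (𝓖.iT (υ.lin.dualMap ζ)))) =
        (l.conj υ.lin).term k p (𝓖'.s (𝓖'.iT ζ)) := by
      rw [υ.iT_dualMap, ← υ.dualMap_s]
      rfl
    rw [υ.rhsTerm_conj, ← e1, ← e2]
    simp only [map_sub]

theorem conj_lcan : 𝓖.lcan.conj υ.lin = 𝓖'.lcan :=
  (υ.isCanonical_conj 𝓖.isCanonical_lcan).eq_lcan

theorem isNormalized_conj {l : FormalL 𝕜 𝔩 𝔤} (hl : 𝓖.IsNormalized l) :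
    𝓖'.IsNormalized (l.conj υ.lin) := by
  refine ⟨fun p => ?_, fun k p => ?_⟩
  · change Bidyn.conj υ.lin (l.term 0 p) = 0
    rw [hl.zero, map_zero]
  · change υ.lin (l.term k p (υ.lin.dualMap (𝓖'.s p))) = 0
    rw [υ.dualMap_s, hl.apply_s, map_zero]

theorem isDynamical_conj {l : FormalL 𝕜 𝔩 𝔤} (hl : 𝓖.IsDynamical l) :
    𝓖'.IsDynamical (l.conj υ.lin) := by
  refine ⟨fun k p ξ η => hl.skew k p (υ.lin.dualMap ξ) (υ.lin.dualMap η), fun k p ξ η ζ => ?_, fun k p z ξ η => ?_⟩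
  -- The correspondence holds before cyclic summation, so the equation for `𝓖'` is the one for `𝓖`
  -- at the pulled-back functionals.
  · have key : ∀ ξ η ζ : Dual 𝕜 𝔤',
        dirDeriv ((l.conj υ.lin).term (k + 1)) p (𝓖'.iT ξ) η ζ
          - ζ (∑ ab ∈ Finset.HasAntidiagonal.antidiagonal k,
            ⁅(l.conj υ.lin).term ab.1 p ξ, (l.conj υ.lin).term ab.2 p η⁆)
          - ζ (𝓖'.ϖ ((l.conj υ.lin).term k p ξ) η) =
        dirDeriv (l.term (k + 1)) p (𝓖.iT (υ.lin.dualMap ξ)) (υ.lin.dualMap η) (υ.lin.dualMap ζ)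
          - υ.lin.dualMap ζ (∑ ab ∈ Finset.HasAntidiagonal.antidiagonal k,
            ⁅l.term ab.1 p (υ.lin.dualMap ξ), l.term ab.2 p (υ.lin.dualMap η)⁆)
          - υ.lin.dualMap ζ (𝓖.ϖ (l.term k p (υ.lin.dualMap ξ)) (υ.lin.dualMap η)) := by
      intro ξ η ζ
      rw [υ.iT_dualMap]
      congr 1
      · congr 1
        refine congrArg ζ (Eq.trans (Finset.sum_congr rfl fun ab _ => ?_) (map_sum υ.lin _ _).symm)
        exact (υ.toLieHom.map_lie _ _).symm
      · exact congrArg ζ (υ.map_ϖ _ η).symm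
    have h := hl.cdybe k p (υ.lin.dualMap ξ) (υ.lin.dualMap η) (υ.lin.dualMap ζ)
    simp only [cycl, key] at h ⊢
    rw [h]
    split_ifs
    · exact congrArg ζ (υ.map_φ ξ η)
    · rfl
  · have h := hl.equivariant k p z (υ.lin.dualMap ξ) (υ.lin.dualMap η)
    have e1 : υ.lin.dualMap η (𝓖.ϖ (𝓖.i z) (υ.lin.dualMap ξ)) = η (𝓖'.ϖ (𝓖'.i z) ξ) := by
      rw [← υ.map_i]
      exact congrArg η (υ.map_ϖ (𝓖.i z) ξ)
    have e2 : υ.lin.dualMap η ⁅𝓖.i z, l.term k p (υ.lin.dualMap ξ)⁆ =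
        η ⁅𝓖'.i z, (l.conj υ.lin).term k p ξ⁆ := by
      rw [← υ.map_i]
      exact congrArg η (υ.toLieHom.map_lie _ _)
    rw [e1, e2, ← υ.dualMap_adT] at h
    exact h

end Hom

end BidynLQB

end Formal

end Bidyn

namespace Bidyn

/-! ### Calculus on manifolds: zero derivative and the chain rule. -/

section LocallyConstant

variable {E : Type*} [NormedAddCommGroup E] [NormedSpace ℝ E]
  {M : Type*} [TopologicalSpace M] [ChartedSpace E M]

/-- A function with vanishing derivative on a connected manifold is constant. -/
theorem eq_of_mfderiv_eq_zero [IsManifold 𝓘(ℝ, E) 1 M] [PreconnectedSpace M] {f : M → ℝ}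
    (hf : MDifferentiable 𝓘(ℝ, E) 𝓘(ℝ, ℝ) f) (h : ∀ x, mfderiv 𝓘(ℝ, E) 𝓘(ℝ, ℝ) f x = 0)
    (x y : M) : f x = f y := by
  refine IsLocallyConstant.apply_eq_of_preconnectedSpace
    ((IsLocallyConstant.iff_eventually_eq f).2 fun x => ?_) x y
  let c := chartAt E x
  -- A ball inside the chart target is convex, which allows the vector space statement to be applied
  -- to `f ∘ c.symm`.
  obtain ⟨r, hr, hball⟩ := Metric.isOpen_iff.1 c.open_target (c x) (mem_chart_target E x)
  have hd : ∀ z ∈ Metric.ball (c x) r, HasFDerivAt (f ∘ c.symm) (0 : E →L[ℝ] ℝ) z := by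
    intro z hz
    have h1 : MDifferentiableAt 𝓘(ℝ, E) 𝓘(ℝ, E) c.symm z :=
      mdifferentiableAt_atlas_symm (chart_mem_atlas E x) (hball hz)
    have h2 := (hf (c.symm z)).hasMFDerivAt.comp z h1.hasMFDerivAt
    rw [h, ContinuousLinearMap.zero_comp] at h2
    exact h2.hasFDerivAt
  have hev : ∀ᶠ y in 𝓝 x, y ∈ c.source ∧ c y ∈ Metric.ball (c x) r :=
    Filter.Eventually.and (c.open_source.mem_nhds (mem_chart_source E x))
      ((c.continuousAt (mem_chart_source E x)).eventually (Metric.ball_mem_nhds _ hr))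
  filter_upwards [hev] with y hy
  have h3 := (convex_ball (c x) r).is_const_of_fderivWithin_eq_zero (𝕜 := ℝ)
    (fun z hz => (hd z hz).differentiableAt.differentiableWithinAt)
    (fun z hz => (hd z hz).hasFDerivWithinAt.fderivWithin
      (Metric.isOpen_ball.uniqueDiffWithinAt hz)) hy.2 (Metric.mem_ball_self hr)
  simpa [c.left_inv hy.1, c.left_inv (mem_chart_source E x)] using h3

end LocallyConstant

section ChainRule

variable {E E' F : Type*} [NormedAddCommGroup E] [NormedSpace ℝ E]
  [NormedAddCommGroup E'] [NormedSpace ℝ E'] [NormedAddCommGroup F] [NormedSpace ℝ F]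
  {M M' N : Type*} [TopologicalSpace M] [ChartedSpace E M]
  [TopologicalSpace M'] [ChartedSpace E' M'] [TopologicalSpace N] [ChartedSpace F N]

/-- The type of `mfderiv` depends on base points. Keeping `y` free and ascribing types over the
model spaces lets the rule be used at `ψ 1 = 1` without dependent rewriting. -/
theorem mfderiv_comp_apply_of_map_eq {g : M' → N} {f : M → M'} {x : M} {y : M'} (hy : f x = y)
    (hg : MDifferentiableAt 𝓘(ℝ, E') 𝓘(ℝ, F) g y) (hf : MDifferentiableAt 𝓘(ℝ, E) 𝓘(ℝ, E') f x)
    (v : E) : (mfderiv 𝓘(ℝ, E) 𝓘(ℝ, F) (fun z => g (f z)) x : E →L[ℝ] F) v =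
      (mfderiv 𝓘(ℝ, E') 𝓘(ℝ, F) g y : E' →L[ℝ] F)
        ((mfderiv 𝓘(ℝ, E) 𝓘(ℝ, E') f x : E →L[ℝ] E') v) := by
  subst hy
  exact mfderiv_comp_apply x hg hf v

end ChainRule

/-! ### Group morphisms, translated derivatives and cocycles. -/

section LieGroup

variable {E E' : Type*} [NormedAddCommGroup E] [NormedSpace ℝ E]
  [NormedAddCommGroup E'] [NormedSpace ℝ E'] {G G' : Type*}
  [TopologicalSpace G] [ChartedSpace E G] [Group G]
  [TopologicalSpace G'] [ChartedSpace E' G'] [Group G'] [LieGroup 𝓘(ℝ, E') ∞ G']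

theorem rightD_one (f : G → ℝ) :
    rightD (E := E) f 1 = (mfderiv 𝓘(ℝ, E) 𝓘(ℝ, ℝ) f 1 : E →L[ℝ] ℝ).toLinearMap := by
  have h : (fun y => f (y * 1)) = f := funext fun y => by rw [mul_one]
  ext v
  have h' := congrArg (fun F : G → ℝ => (mfderiv 𝓘(ℝ, E) 𝓘(ℝ, ℝ) F 1 : E →L[ℝ] ℝ) v) h
  exact h'

/-- A morphism intertwines right translation by `x` with that by `ψ x`, so only its tangent map at
`1` appears. -/
theorem rightD_comp {ψ : G →* G'} (hψ : ContMDiff 𝓘(ℝ, E) 𝓘(ℝ, E') ∞ ψ) {f : G' → ℝ}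
    (hf : ContMDiff 𝓘(ℝ, E') 𝓘(ℝ, ℝ) ∞ f) (x : G) :
    rightD (E := E) (fun y => f (ψ y)) x =
      (tangentOne (E := E) (E' := E') ψ).dualMap (rightD (E := E') f (ψ x)) := by
  ext v
  have h : (fun y => f (ψ (y * x))) = fun y => (fun y' => f (y' * ψ x)) (ψ y) := by
    funext y
    rw [map_mul]
  have hg : ContMDiff 𝓘(ℝ, E') 𝓘(ℝ, ℝ) ∞ fun y' => f (y' * ψ x) :=
    hf.comp (contMDiff_mul_right (a := ψ x))
  have := mfderiv_comp_apply_of_map_eq (map_one ψ) (hg.mdifferentiable (by simp) 1)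
    (hψ.mdifferentiable (by simp) 1) v
  rw [← h] at this
  exact this

theorem leftD_comp {ψ : G →* G'} (hψ : ContMDiff 𝓘(ℝ, E) 𝓘(ℝ, E') ∞ ψ) {f : G' → ℝ}
    (hf : ContMDiff 𝓘(ℝ, E') 𝓘(ℝ, ℝ) ∞ f) (x : G) :
    leftD (E := E) (fun y => f (ψ y)) x =
      (tangentOne (E := E) (E' := E') ψ).dualMap (leftD (E := E') f (ψ x)) := by
  ext v
  have h : (fun y => f (ψ (x * y))) = fun y => (fun y' => f (ψ x * y')) (ψ y) := by
    funext y
    rw [map_mul]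
  have hg : ContMDiff 𝓘(ℝ, E') 𝓘(ℝ, ℝ) ∞ fun y' => f (ψ x * y') :=
    hf.comp (contMDiff_mul_left (a := ψ x))
  have := mfderiv_comp_apply_of_map_eq (map_one ψ) (hg.mdifferentiable (by simp) 1)
    (hψ.mdifferentiable (by simp) 1) v
  rw [← h] at this
  exact this

variable [LieGroup 𝓘(ℝ, E) ∞ G]

theorem tangentOne_Ad {ψ : G →* G'} (hψ : ContMDiff 𝓘(ℝ, E) 𝓘(ℝ, E') ∞ ψ) (x : G) :
    tangentOne (E := E) (E' := E') ψ ∘ₗ Ad (E := E) x =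
      Ad (E := E') (ψ x) ∘ₗ tangentOne (E := E) (E' := E') ψ := by
  have hc : ∀ x : G, ContMDiff 𝓘(ℝ, E) 𝓘(ℝ, E) ∞ fun y => x * y * x⁻¹ := fun x =>
    (contMDiff_mul_right (a := x⁻¹)).comp (contMDiff_mul_left (a := x))
  have hc' : ContMDiff 𝓘(ℝ, E') 𝓘(ℝ, E') ∞ fun y => ψ x * y * (ψ x)⁻¹ :=
    (contMDiff_mul_right (a := (ψ x)⁻¹)).comp (contMDiff_mul_left (a := ψ x))
  have h : (fun y => ψ (x * y * x⁻¹)) = fun y => ψ x * ψ y * (ψ x)⁻¹ := by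
    funext y
    simp
  ext v
  have h1 := mfderiv_comp_apply_of_map_eq (f := fun y => x * y * x⁻¹) (x := 1) (y := 1) (by simp)
    (hψ.mdifferentiable (by simp) 1) ((hc x).mdifferentiable (by simp) 1) v
  have h2 := mfderiv_comp_apply_of_map_eq (map_one ψ) (hc'.mdifferentiable (by simp) 1)
    (hψ.mdifferentiable (by simp) 1) v
  rw [h] at h1
  exact h1.symm.trans h2

/-- Two group cocycles intertwined infinitesimally by a morphism are intertwined by it, if the
source is connected. -/
theorem IntegratesCocycle.conj_eq [ConnectedSpace G]
    {π : G → Dual ℝ (LieAlg E G) →ₗ[ℝ] LieAlg E G}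
    {ϖ : LieAlg E G →ₗ[ℝ] Dual ℝ (LieAlg E G) →ₗ[ℝ] LieAlg E G}
    {π' : G' → Dual ℝ (LieAlg E' G') →ₗ[ℝ] LieAlg E' G'}
    {ϖ' : LieAlg E' G' →ₗ[ℝ] Dual ℝ (LieAlg E' G') →ₗ[ℝ] LieAlg E' G'}
    (h : IntegratesCocycle π ϖ) (h' : IntegratesCocycle π' ϖ')
    {ψ : G →* G'} (hψ : ContMDiff 𝓘(ℝ, E) 𝓘(ℝ, E') ∞ ψ)
    (hϖ : ∀ u, conj (tangentOne (E := E) (E' := E') ψ) (ϖ u) =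
      ϖ' (tangentOne (E := E) (E' := E') ψ u)) (x : G) :
    conj (tangentOne (E := E) (E' := E') ψ) (π x) = π' (ψ x) := by
  set f := tangentOne (E := E) (E' := E') ψ with hfdef
  -- This difference is a cocycle of `G` for the action through `Ad ∘ ψ`; the goal is `c = 0`.
  let c : G → Dual ℝ (LieAlg E' G') →ₗ[ℝ] LieAlg E' G' := fun x => conj f (π x) - π' (ψ x)
  have hc : ∀ x y, c (x * y) = c x + conj (Ad (E := E') (ψ x)) (c y) := by
    intro x y
    have e : conj f (conj (Ad (E := E) x) (π y)) = conj (Ad (E := E') (ψ x)) (conj f (π y)) := by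
      change conj (f ∘ₗ Ad (E := E) x) (π y) = conj (Ad (E := E') (ψ x) ∘ₗ f) (π y)
      rw [tangentOne_Ad hψ]
    simp only [c, map_mul, h.cocycle, h'.cocycle, map_add, map_sub, e]
    abel
  have hfun : ∀ ξ η : Dual ℝ (LieAlg E' G'), (fun x => η (c x ξ)) =
      (fun x => f.dualMap η (π x (f.dualMap ξ))) - (fun x => η (π' x ξ)) ∘ ψ := by
    intro ξ η
    funext x
    exact map_sub η _ _
  have hs : ∀ ξ η : Dual ℝ (LieAlg E' G'), ContMDiff 𝓘(ℝ, E) 𝓘(ℝ, ℝ) ∞ fun x => η (c x ξ) := fun ξ η => by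
    rw [hfun]
    exact (h.smooth (f.dualMap ξ) (f.dualMap η)).sub ((h'.smooth ξ η).comp hψ)
  have h1 : ∀ ξ η : Dual ℝ (LieAlg E' G'), mfderiv 𝓘(ℝ, E) 𝓘(ℝ, ℝ) (fun x => η (c x ξ)) 1 = 0 := by
    intro ξ η
    ext v
    have e1 := h.tangent (f.dualMap ξ) (f.dualMap η) v
    have e2 := h'.tangent ξ η (f v)
    have e3 := LinearMap.congr_fun (rightD_comp hψ (h'.smooth ξ η) 1) v
    rw [map_one ψ] at e3
    rw [rightD_one] at e1 e3
    have e4 := ((h.smooth (f.dualMap ξ) (f.dualMap η)).mdifferentiable (by simp) 1).hasMFDerivAt.sub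
      (((h'.smooth ξ η).comp hψ).mdifferentiable (by simp) 1).hasMFDerivAt
    have e5 := congrArg (fun L => (L : E →L[ℝ] ℝ) v) e4.mfderiv
    rw [← hfun] at e5
    refine e5.trans ?_
    refine (congrArg₂ (· - ·) e1 (e3.trans e2)).trans ?_
    exact sub_eq_zero.2 (congrArg η (LinearMap.congr_fun (hϖ v) ξ))
  -- By the cocycle rule, `y ↦ c (x y)` is a constant plus `c` twisted by `Ad (ψ x)`. Its derivative
  -- at `1` is therefore covered by `h1` at the twisted functionals, and writing `y = x (x⁻¹ y)`
  -- carries this to the point `x`.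
  have h2 : ∀ (ξ η : Dual ℝ (LieAlg E' G')) (x : G), mfderiv 𝓘(ℝ, E) 𝓘(ℝ, ℝ) (fun x => η (c x ξ)) x = 0 := by
    intro ξ η x
    let A := (Ad (E := E') (ψ x)).dualMap
    have e1 : (fun y => η (c (x * y) ξ)) = fun y => η (c x ξ) + A η (c y (A ξ)) := by
      funext y
      rw [hc, LinearMap.add_apply, map_add]
      rfl
    have e2 : HasMFDerivAt 𝓘(ℝ, E) 𝓘(ℝ, ℝ) (fun y => A η (c y (A ξ))) 1 0 := by
      have := ((hs (A ξ) (A η)).mdifferentiable (by simp) 1).hasMFDerivAt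
      rwa [h1] at this
    have e3 := ((hasMFDerivAt_const (I := 𝓘(ℝ, E)) (I' := 𝓘(ℝ, ℝ)) (η (c x ξ)) (1 : G)).add
      e2).mfderiv
    have e4 : (fun y => η (c y ξ)) = fun y => (fun z => η (c (x * z) ξ)) (x⁻¹ * y) := by
      funext y
      simp
    have hg : ContMDiff 𝓘(ℝ, E) 𝓘(ℝ, ℝ) ∞ fun z => η (c (x * z) ξ) :=
      (hs ξ η).comp (contMDiff_mul_left (a := x))
    ext v
    have e5 := mfderiv_comp_apply_of_map_eq (E := E) (E' := E) (f := fun y : G => x⁻¹ * y)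
      (inv_mul_cancel x) (hg.mdifferentiable (by simp) 1)
      ((contMDiff_mul_left (I := 𝓘(ℝ, E)) (n := ∞) (a := x⁻¹)).mdifferentiable (by simp) x) v
    rw [← e4] at e5
    refine e5.trans ?_
    rw [e1]
    refine (congrArg (fun L => (L : E →L[ℝ] ℝ) _) e3).trans ?_
    exact add_zero (0 : ℝ)
  -- The cocycle rule at `(1, 1)` reads `c 1 = c 1 + c 1`.
  have h3 : c 1 = 0 := by
    have hA : Ad (E := E') (1 : G') = LinearMap.id := by
      have e : (fun y : G' => 1 * y * 1⁻¹) = id := by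
        funext y
        simp
      rw [Ad, e, mfderiv_id]
      rfl
    have e := hc 1 1
    rw [map_one, hA, mul_one] at e
    exact left_eq_add.1 e
  have hM : IsManifold 𝓘(ℝ, E) 1 G := IsManifold.of_le (n := ∞) (by simp)
  refine sub_eq_zero.1 (show c x = 0 from ?_)
  refine LinearMap.ext fun ξ => Module.eval_apply_injective ℝ (LinearMap.ext fun η => ?_)
  have := eq_of_mfderiv_eq_zero ((hs ξ η).mdifferentiable (by simp)) (h2 ξ η) x 1
  rw [h3] at this
  simpa using this

end LieGroup

end Bidyn

namespace Bidyn

/-! ### Analytic realizations of formal maps. -/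

section Realization

variable {𝔩 : Type*} [LieRing 𝔩] [LieAlgebra ℝ 𝔩] [FiniteDimensional ℝ 𝔩]
  {𝔤 𝔤' : Type*} [LieRing 𝔤] [LieAlgebra ℝ 𝔤] [LieRing 𝔤'] [LieAlgebra ℝ 𝔤']
  {U : TopologicalSpace.Opens (Dual ℝ 𝔩)}

theorem Realizes.conj {l : Dual ℝ 𝔩 → Dual ℝ 𝔤 →ₗ[ℝ] 𝔤} {lf : FormalL ℝ 𝔩 𝔤}
    (h : Realizes U l lf) (f : 𝔤 →ₗ[ℝ] 𝔤') :
    Realizes U (fun p => Bidyn.conj f (l p)) (lf.conj f) :=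
  ⟨fun ξ η => h.analytic (f.dualMap ξ) (f.dualMap η),
    fun ξ η => h.taylor (f.dualMap ξ) (f.dualMap η)⟩

/-- Two analytic maps on a connected neighbourhood of `0` with the same Taylor expansion agree. -/
theorem Realizes.eqOn {l l' : Dual ℝ 𝔩 → Dual ℝ 𝔤 →ₗ[ℝ] 𝔤} {lf : FormalL ℝ 𝔩 𝔤}
    (h : Realizes U l lf) (h' : Realizes U l' lf) (hU : IsPreconnected (U : Set (Dual ℝ 𝔩)))
    (h0 : 0 ∈ U) {p : Dual ℝ 𝔩} (hp : p ∈ U) : l p = l' p := by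
  refine LinearMap.ext fun ξ => Module.eval_apply_injective ℝ (LinearMap.ext fun η => ?_)
  -- Near `0` both functions are sums of the same series; the identity theorem spreads this over
  -- `U`.
  refine (h.analytic ξ η).eqOn_of_preconnected_of_eventuallyEq (h'.analytic ξ η) hU h0 ?_ hp
  filter_upwards [h.taylor ξ η, h'.taylor ξ η] with q hq hq'
  exact hq.unique hq'

end Realization

/-! ### The bracket on the trivial groupoid. -/

section Groupoid

variable {𝔩 E E' G G' : Type*}
  [LieRing 𝔩] [LieAlgebra ℝ 𝔩] [FiniteDimensional ℝ 𝔩]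
  [NormedAddCommGroup E] [NormedSpace ℝ E] [FiniteDimensional ℝ E]
  [NormedAddCommGroup E'] [NormedSpace ℝ E'] [FiniteDimensional ℝ E']
  [TopologicalSpace G] [ChartedSpace E G] [Group G] [LieGroup 𝓘(ℝ, E) ∞ G]
  [TopologicalSpace G'] [ChartedSpace E' G'] [Group G'] [LieGroup 𝓘(ℝ, E') ∞ G']
  {𝓖 : BidynLQB ℝ 𝔩 (LieAlg E G)} {𝓖' : BidynLQB ℝ 𝔩 (LieAlg E' G')}
  {U : TopologicalSpace.Opens (Dual ℝ 𝔩)}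

/-- The derivatives along `U` are unaffected because both base points are fixed, and those along the
group are pulled back by `υ*`. Pairing `υ* a` with `l υ* b` pairs `a` with `υ l υ* b`, and the terms
in `i` use `υ i = i'`. -/
theorem dynBracket_comp (υ : 𝓖.Hom 𝓖')
    {l : Dual ℝ 𝔩 → Dual ℝ (LieAlg E G) →ₗ[ℝ] LieAlg E G}
    {l' : Dual ℝ 𝔩 → Dual ℝ (LieAlg E' G') →ₗ[ℝ] LieAlg E' G'}
    (hl : ∀ p ∈ U, conj υ.lin (l p) = l' p)
    {π : G → Dual ℝ (LieAlg E G) →ₗ[ℝ] LieAlg E G}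
    {π' : G' → Dual ℝ (LieAlg E' G') →ₗ[ℝ] LieAlg E' G'}
    {ψ : G →* G'} (hψ : ContMDiff 𝓘(ℝ, E) 𝓘(ℝ, E') ∞ ψ)
    (hυ : tangentOne (E := E) (E' := E') ψ = υ.lin) (hπ : ∀ x, conj υ.lin (π x) = π' (ψ x))
    {f g : U × G' × U → ℝ} (hf : ContMDiff (groupoidModel 𝔩 E') 𝓘(ℝ, ℝ) ∞ f)
    (hg : ContMDiff (groupoidModel 𝔩 E') 𝓘(ℝ, ℝ) ∞ g) (a : U × G × U) :
    dynBracket 𝓖 U l π (fun b => f (b.1, ψ b.2.1, b.2.2)) (fun b => g (b.1, ψ b.2.1, b.2.2)) a =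
      dynBracket 𝓖' U l' π' f g (a.1, ψ a.2.1, a.2.2) := by
  obtain ⟨p, x, q⟩ := a
  have hslice : ∀ {h : U × G' × U → ℝ}, ContMDiff (groupoidModel 𝔩 E') 𝓘(ℝ, ℝ) ∞ h →
      ContMDiff 𝓘(ℝ, E') 𝓘(ℝ, ℝ) ∞ fun y => h (p, y, q) := fun hh =>
    hh.comp (contMDiff_const.prodMk (contMDiff_id.prodMk contMDiff_const))
  have hD : ∀ {h : U × G' × U → ℝ}, ContMDiff (groupoidModel 𝔩 E') 𝓘(ℝ, ℝ) ∞ h →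
      rightD (E := E) (fun y => h (p, ψ y, q)) x =
        υ.lin.dualMap (rightD (E := E') (fun y => h (p, y, q)) (ψ x)) := fun hh =>
    (rightD_comp hψ (hslice hh) x).trans (by rw [hυ])
  have hD' : ∀ {h : U × G' × U → ℝ}, ContMDiff (groupoidModel 𝔩 E') 𝓘(ℝ, ℝ) ∞ h →
      leftD (E := E) (fun y => h (p, ψ y, q)) x =
        υ.lin.dualMap (leftD (E := E') (fun y => h (p, y, q)) (ψ x)) := fun hh =>
    (leftD_comp hψ (hslice hh) x).trans (by rw [hυ])
  have hi : ∀ z, υ.lin (𝓖.i z) = 𝓖'.i z := υ.map_i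
  simp only [dynBracket, hD hf, hD hg, hD' hf, hD' hg, LinearMap.dualMap_apply, hi,
    ← hl p p.2, ← hl q q.2, ← hπ x]
  rfl

theorem isPoissonGroupoidMorphism_of_hom (υ : 𝓖.Hom 𝓖')
    {l : Dual ℝ 𝔩 → Dual ℝ (LieAlg E G) →ₗ[ℝ] LieAlg E G}
    {l' : Dual ℝ 𝔩 → Dual ℝ (LieAlg E' G') →ₗ[ℝ] LieAlg E' G'}
    (hl : ∀ p ∈ U, conj υ.lin (l p) = l' p)
    {π : G → Dual ℝ (LieAlg E G) →ₗ[ℝ] LieAlg E G}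
    {π' : G' → Dual ℝ (LieAlg E' G') →ₗ[ℝ] LieAlg E' G'}
    {ψ : G →* G'} (hψ : ContMDiff 𝓘(ℝ, E) 𝓘(ℝ, E') ∞ ψ)
    (hυ : tangentOne (E := E) (E' := E') ψ = υ.lin) (hπ : ∀ x, conj υ.lin (π x) = π' (ψ x)) :
    IsPoissonGroupoidMorphism (E := E) (E' := E') (dynBracket 𝓖 U l π) (dynBracket 𝓖' U l' π')
      (fun a : U × G × U => (a.1, ψ a.2.1, a.2.2)) where
  smooth := contMDiff_fst.prodMk
    ((hψ.comp (contMDiff_fst.comp contMDiff_snd)).prodMk (contMDiff_snd.comp contMDiff_snd))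
  source _ := rfl
  target _ := rfl
  unit p := by simp
  mul a a' h := by simp [gpdMul]
  poisson f g hf hg := funext fun a => dynBracket_comp υ hl hψ hυ hπ hf hg a

end Groupoid

end Bidyn

/-! ### The proposition. -/

theorem mainTheorem9 :
    (∀ (𝕜 : Type*) [RCLike 𝕜] (𝔩 𝔤 𝔤' : Type*)
      [LieRing 𝔩] [LieAlgebra 𝕜 𝔩]
      [LieRing 𝔤] [LieAlgebra 𝕜 𝔤] [FiniteDimensional 𝕜 𝔤]
      [LieRing 𝔤'] [LieAlgebra 𝕜 𝔤'] [FiniteDimensional 𝕜 𝔤']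
      (𝓖 : Bidyn.BidynLQB 𝕜 𝔩 𝔤) (𝓖' : Bidyn.BidynLQB 𝕜 𝔩 𝔤') (υ : 𝓖.Hom 𝓖'),
      𝓖.lcan.conj (υ.toLieHom : 𝔤 →ₗ[𝕜] 𝔤') = 𝓖'.lcan ∧
      ∀ l : Bidyn.FormalL 𝕜 𝔩 𝔤, 𝓖.IsDynamical l → 𝓖.IsNormalized l →
        l = 𝓖.lcan ∧
        𝓖'.IsDynamical (l.conj (υ.toLieHom : 𝔤 →ₗ[𝕜] 𝔤')) ∧
        𝓖'.IsNormalized (l.conj (υ.toLieHom : 𝔤 →ₗ[𝕜] 𝔤'))) ∧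
    (∀ (𝔩 E E' G G' : Type*)
      [LieRing 𝔩] [LieAlgebra ℝ 𝔩] [FiniteDimensional ℝ 𝔩]
      [NormedAddCommGroup E] [NormedSpace ℝ E] [FiniteDimensional ℝ E]
      [NormedAddCommGroup E'] [NormedSpace ℝ E'] [FiniteDimensional ℝ E']
      [TopologicalSpace G] [ChartedSpace E G] [Group G] [LieGroup 𝓘(ℝ, E) ∞ G] [ConnectedSpace G]
      [TopologicalSpace G'] [ChartedSpace E' G'] [Group G'] [LieGroup 𝓘(ℝ, E') ∞ G']
      (𝓖 : Bidyn.BidynLQB ℝ 𝔩 (Bidyn.LieAlg E G)) (𝓖' : Bidyn.BidynLQB ℝ 𝔩 (Bidyn.LieAlg E' G'))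
      (υ : 𝓖.Hom 𝓖')
      (U : TopologicalSpace.Opens (Module.Dual ℝ 𝔩)) (_ : IsPreconnected (U : Set (Module.Dual ℝ 𝔩)))
      (_ : 0 ∈ U)
      (l : Module.Dual ℝ 𝔩 → Module.Dual ℝ (Bidyn.LieAlg E G) →ₗ[ℝ] Bidyn.LieAlg E G)
      (_ : Bidyn.Realizes U l 𝓖.lcan),
      Bidyn.Realizes U
        (fun p => Bidyn.conj (υ.toLieHom : Bidyn.LieAlg E G →ₗ[ℝ] Bidyn.LieAlg E' G') (l p))
        𝓖'.lcan ∧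
      ∀ (l' : Module.Dual ℝ 𝔩 → Module.Dual ℝ (Bidyn.LieAlg E' G') →ₗ[ℝ] Bidyn.LieAlg E' G')
        (_ : Bidyn.Realizes U l' 𝓖'.lcan),
        (∀ p ∈ U,
          Bidyn.conj (υ.toLieHom : Bidyn.LieAlg E G →ₗ[ℝ] Bidyn.LieAlg E' G') (l p) = l' p) ∧
        ∀ (π : G → Module.Dual ℝ (Bidyn.LieAlg E G) →ₗ[ℝ] Bidyn.LieAlg E G)
          (π' : G' → Module.Dual ℝ (Bidyn.LieAlg E' G') →ₗ[ℝ] Bidyn.LieAlg E' G')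
          (_ : Bidyn.IntegratesCocycle π 𝓖.ϖ) (_ : Bidyn.IntegratesCocycle π' 𝓖'.ϖ)
          (ψ : G →* G') (_ : ContMDiff 𝓘(ℝ, E) 𝓘(ℝ, E') ∞ ψ)
          (_ : Bidyn.tangentOne (E := E) (E' := E') ψ =
            (υ.toLieHom : Bidyn.LieAlg E G →ₗ[ℝ] Bidyn.LieAlg E' G')),
          Bidyn.IsPoissonGroupoidMorphism (E := E) (E' := E')
            (Bidyn.dynBracket 𝓖 U l π) (Bidyn.dynBracket 𝓖' U l' π')
            (fun a : U × G × U => (a.1, ψ a.2.1, a.2.2))) := by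
  refine ⟨?_, ?_⟩
  · intro 𝕜 _ 𝔩 𝔤 𝔤' _ _ _ _ _ _ _ _ 𝓖 𝓖' υ
    exact ⟨υ.conj_lcan, fun l hl hn => ⟨(hl.isCanonical 𝓖 hn).eq_lcan, υ.isDynamical_conj hl,
      υ.isNormalized_conj hn⟩⟩
  · intro 𝔩 E E' G G' _ _ _ _ _ _ _ _ _ _ _ _ _ _ _ _ _ _ 𝓖 𝓖' υ U hU h0 l hl
    have hc : Bidyn.Realizes U (fun p => Bidyn.conj υ.lin (l p)) 𝓖'.lcan := by
      rw [← υ.conj_lcan]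
      exact hl.conj υ.lin
    refine ⟨hc, fun l' hl' => ?_⟩
    have heq : ∀ p ∈ U, Bidyn.conj υ.lin (l p) = l' p := fun p hp => hc.eqOn hl' hU h0 hp
    refine ⟨heq, fun π π' hπ hπ' ψ hψ hυ => ?_⟩
    refine Bidyn.isPoissonGroupoidMorphism_of_hom υ heq hψ hυ fun x => ?_
    -- The infinitesimal hypothesis on the cocycles is the compatibility of `υ` with `ϖ`, once `T₁ψ`
    -- is replaced by `υ`.
    have h := hπ.conj_eq hπ' hψ (fun u => LinearMap.ext fun ξ => ?_) x
    · rwa [hυ] at h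
    · rw [hυ]
      exact υ.map_ϖ u ξ
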